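/- Let $\Sigma$ be a Riemann surface equipped with a complete conformal hyperbolic metric $k$ (that is, $k$ is a smooth metric, $k=\lambda\,|dz|^2$ in each local holomorphic coordinate $z$, of constant Gauss curvature $-1$). Let $U$ be a holomorphic cubic differential on $\Sigma$, locally $U=U(z)\,dz^3$, and let $u\colon\Sigma\to\mathbb R$ be a $C^2$ solution of Wang's equation relative to $k$, $$\Delta_k u + 4e^{-2u}\|U\|_k^2 - 2e^u + 2 = 0,$$ where $\Delta_k=\lambda^{-1}(\partial_x^2+\partial_y^2)$ is the Laplacian of $k$ and $\|U\|_k^2=|U(z)|^2/\lambda^3$. If the Blaschke metric $h=e^uk$ is complete, then $h\ge k$ on $\Sigma$, i.e. $h(v,v)\ge k(v,v)$ for every tangent vector $v$. -/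

import Mathlib

open scoped Manifold ContDiff Topology InnerProductSpace Bundle
open Filter Laplacian

noncomputable section

namespace WangSurface

/-- The smooth real surface underlying a Riemann surface: a holomorphic atlas is in particular
a real-analytic atlas, so that real tangent spaces and Riemannian metrics are available. -/
instance isManifold_real (S : Type*) [TopologicalSpace S] [ChartedSpace ℂ S]
    [hS : IsManifold 𝓘(ℂ) ω S] (n : ℕ∞ω) : IsManifold 𝓘(ℝ, ℂ) n S := by
  apply isManifold_of_contDiffOn
  intro e e' he he'
  have h := (contDiffGroupoid ω 𝓘(ℂ)).compatible he he'
  rw [contDiffGroupoid, mem_groupoid_of_pregroupoid] at h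
  exact (ContDiffOn.restrict_scalars ℝ h.1).of_le le_top

variable {S : Type*} [TopologicalSpace S] [ChartedSpace ℂ S]

/-- A Riemannian metric on the real tangent bundle of `S`
(no regularity in the base point is imposed here). -/
abbrev Metric (S : Type*) [TopologicalSpace S] [ChartedSpace ℂ S] : Type _ :=
  Bundle.RiemannianMetric (fun p : S ↦ TangentSpace 𝓘(ℝ, ℂ) p)

/-- A `C^∞` Riemannian metric on the real tangent bundle of the Riemann surface `S`. -/
abbrev SmoothMetric (S : Type*) [TopologicalSpace S] [ChartedSpace ℂ S]
    [IsManifold 𝓘(ℂ) ω S] : Type _ :=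
  Bundle.ContMDiffRiemannianMetric 𝓘(ℝ, ℂ) ∞ ℂ (fun p : S ↦ TangentSpace 𝓘(ℝ, ℂ) p)

/-- `φ` is a holomorphic (local conformal) coordinate `z = x + i y` on an open part of `S`. -/
def IsHolChart (φ : OpenPartialHomeomorph S ℂ) : Prop :=
  φ ∈ IsManifold.maximalAtlas 𝓘(ℂ) ω S

/-- The real tangent vector of `S` at `φ⁻¹ z` whose expression in the coordinate `φ` is
`ξ = ξ₁ + i ξ₂`, that is, `ξ₁ ∂/∂x + ξ₂ ∂/∂y`. -/
def realVec (φ : OpenPartialHomeomorph S ℂ) (z ξ : ℂ) : TangentSpace 𝓘(ℝ, ℂ) (φ.symm z) :=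
  mfderiv 𝓘(ℝ, ℂ) 𝓘(ℝ, ℂ) φ.symm z ξ

/-- The coordinate vector `∂/∂z` at `φ⁻¹ z` in the holomorphic tangent space. -/
def holVec (φ : OpenPartialHomeomorph S ℂ) (z : ℂ) : TangentSpace 𝓘(ℂ) (φ.symm z) :=
  mfderiv 𝓘(ℂ) 𝓘(ℂ) φ.symm z (1 : ℂ)

/-- The density `λ = g(∂/∂x, ∂/∂x)` of `g` in the coordinate `φ`;
for conformal `g` one has `g = λ |dz|²`. -/
def density (g : Metric S) (φ : OpenPartialHomeomorph S ℂ) (z : ℂ) : ℝ :=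
  g.inner (φ.symm z) (realVec φ z 1) (realVec φ z 1)

/-- `g` is conformal: `g = λ |dz|²` in every holomorphic coordinate. -/
def IsConformal (g : Metric S) : Prop :=
  ∀ φ : OpenPartialHomeomorph S ℂ, IsHolChart φ → ∀ z ∈ φ.target, ∀ ξ η : ℂ,
    g.inner (φ.symm z) (realVec φ z ξ) (realVec φ z η) = density g φ z * inner ℝ ξ η

/-- The Gauss curvature `κ = -(1/2) λ⁻¹ (∂²/∂x² + ∂²/∂y²) log λ` of a conformal metric
`g = λ |dz|²`, in the coordinate `φ`. -/
def gaussCurvature (g : Metric S) (φ : OpenPartialHomeomorph S ℂ) (z : ℂ) : ℝ :=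
  -(Δ (fun w : ℂ ↦ Real.log (density g φ w)) z) / (2 * density g φ z)

/-- `g` is a conformal metric of constant Gauss curvature `-1`. -/
def IsConformalHyperbolic (g : Metric S) : Prop :=
  IsConformal g ∧ ∀ φ : OpenPartialHomeomorph S ℂ, IsHolChart φ → ∀ z ∈ φ.target,
    gaussCurvature g φ z = -1

/-- `g` is complete: every Cauchy sequence for the Riemannian distance of `g` converges. -/
def IsCompleteMetric (g : Metric S) : Prop :=
  letI : Bundle.RiemannianBundle (fun p : S ↦ TangentSpace 𝓘(ℝ, ℂ) p) := ⟨g⟩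
  ∀ x : ℕ → S,
    (∀ ε : ENNReal, 0 < ε → ∃ N : ℕ, ∀ m ≥ N, ∀ n ≥ N,
      Manifold.riemannianEDist 𝓘(ℝ, ℂ) (x m) (x n) < ε) →
    ∃ p : S, Tendsto x atTop (𝓝 p)

/-- A holomorphic cubic differential: a complex trilinear form on each holomorphic tangent line
(automatically symmetric, the line being one-dimensional) whose coefficient
`U(∂/∂z, ∂/∂z, ∂/∂z)` is a holomorphic function of `z` in every holomorphic coordinate,
i.e. locally `U = U(z) dz³`. -/
structure CubicDifferential (S : Type*) [TopologicalSpace S] [ChartedSpace ℂ S] where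
  form (p : S) : TangentSpace 𝓘(ℂ) p →ₗ[ℂ] TangentSpace 𝓘(ℂ) p →ₗ[ℂ] TangentSpace 𝓘(ℂ) p →ₗ[ℂ] ℂ
  holomorphic (φ : OpenPartialHomeomorph S ℂ) (hφ : IsHolChart φ) :
    DifferentiableOn ℂ
      (fun z ↦ form (φ.symm z) (holVec φ z) (holVec φ z) (holVec φ z)) φ.target

/-- The coefficient `U(z)` of `U = U(z) dz³` in the coordinate `φ`. -/
def CubicDifferential.coeff (U : CubicDifferential S) (φ : OpenPartialHomeomorph S ℂ) (z : ℂ) :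
    ℂ :=
  U.form (φ.symm z) (holVec φ z) (holVec φ z) (holVec φ z)

/-- The squared norm `‖U‖² = |U(z)|² / λ³` of a cubic differential with respect to the conformal
metric `g = λ |dz|²`, in the coordinate `φ`. -/
def cubicNormSq (g : Metric S) (U : CubicDifferential S) (φ : OpenPartialHomeomorph S ℂ)
    (z : ℂ) : ℝ :=
  ‖U.coeff φ z‖ ^ 2 / density g φ z ^ 3

/-- The Laplacian `Δ_g u = λ⁻¹ (∂²/∂x² + ∂²/∂y²) u` of the conformal metric `g = λ |dz|²`,
in the coordinate `φ`. -/
def laplaceBeltrami (g : Metric S) (u : S → ℝ) (φ : OpenPartialHomeomorph S ℂ) (z : ℂ) : ℝ :=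
  Δ (fun w : ℂ ↦ u (φ.symm w)) z / density g φ z

/-- `u` is a classical (`C²`) solution of Wang's equation
`Δ_g u + 4 e^{-2u} ‖U‖_g² - 2 e^u - 2 κ_g = 0` relative to the conformal background metric `g`. -/
def SolvesWang (g : Metric S) (U : CubicDifferential S) (u : S → ℝ) : Prop :=
  ContMDiff 𝓘(ℝ, ℂ) 𝓘(ℝ) 2 u ∧
  ∀ φ : OpenPartialHomeomorph S ℂ, IsHolChart φ → ∀ z ∈ φ.target,
    laplaceBeltrami g u φ z + 4 * Real.exp (-2 * u (φ.symm z)) * cubicNormSq g U φ z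
      - 2 * Real.exp (u (φ.symm z)) - 2 * gaussCurvature g φ z = 0

end WangSurface

end

/-! Let `λ` be the density of `k`, so that `h` has density `e^u λ`. The cubic term of Wang's
equation is nonnegative and `k` has curvature `-1`, hence `Δ_k u ≤ 2 e^u - 2`. Read relative to `h`,
this single inequality says two things: `h` has curvature at least `-1`, and `w = -u` satisfies `Δ_h
w ≥ 2 e^w - 2`. Since `h` is complete, an Ahlfors–Schwarz–Yau argument
(`IsConformalAtlas.nonpos_of_laplacian_ge`) yields `w ≤ 0`, which is `e^u ≥ 1`.

For that argument let `r` be the `h`-distance from `o`. Closed balls are compact by Hopf–Rinow, so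
`w + 2 log (1 - r² / R²)` attains a maximum on the ball of radius `R`. Laplacian comparison for `r`
at the maximum point bounds `2 e^{w(o)} - 2` by a constant times `1 / R`, and `R` is arbitrary.

As `r` is not smooth, its Laplacian is replaced by sums over the four points `f (τ i^j)` of a
holomorphic germ `f`. For a `C²` function `G` such a sum is `4 G + τ² |f'|² Δ G + o(τ²)`
(`deriv_sum_four`). For `r` only an upper bound is needed, namely `FourPointBound`. No geodesic
equation or cut locus enters: a point is joined to `o` by a finite chain of points realising the
distance, with each short link inside a chart region that carries a nearly parallel unit frame.
Nearly minimal curves along a link are displaced by `V f (τ i^j)`, where `V` is a rotated frame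
vector times a weight whose link-end values are `e^r - 1`, zero at `o`. Second variation with
curvature at least `-1` controls the sum of the four lengths (`eventually_exists_variation`), and
the triangle inequality adds up the links. A change of holomorphic chart merely replaces the germ,
so the links fit together. -/

noncomputable section

namespace WangSurface

/-! ### Uniform Taylor bounds and four-point sums. -/

/-- Second-order Taylor upper bound for a real function on `[0, τ]`. -/
theorem le_taylor_two {y y₁ y₂ : ℝ → ℝ} {τ m : ℝ} (hτ : 0 ≤ τ)
    (h₁ : ∀ t ∈ Set.Icc 0 τ, HasDerivAt y (y₁ t) t)
    (h₂ : ∀ t ∈ Set.Icc 0 τ, HasDerivAt y₁ (y₂ t) t)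
    (hm : ∀ t ∈ Set.Icc 0 τ, y₂ t ≤ m) :
    y τ ≤ y 0 + τ * y₁ 0 + τ ^ 2 * (m / 2) := by
  have hI : ∀ t ∈ Set.Icc 0 τ, y₁ t ≤ y₁ 0 + t * m := by
    intro t ht
    have hd : ∀ s ∈ Set.Icc 0 τ, HasDerivAt (fun s ↦ s * m - y₁ s) (1 * m - y₂ s) s := fun s hs ↦
      ((hasDerivAt_id s).mul_const m).sub (h₂ s hs)
    have hmono : MonotoneOn (fun s ↦ s * m - y₁ s) (Set.Icc 0 τ) := by
      refine monotoneOn_of_deriv_nonneg (convex_Icc _ _)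
        (fun s hs ↦ (hd s hs).continuousAt.continuousWithinAt)
        (fun s hs ↦ (hd s (interior_subset hs)).differentiableAt.differentiableWithinAt) ?_
      intro s hs
      rw [(hd s (interior_subset hs)).deriv]
      linarith [hm s (interior_subset hs)]
    have := hmono (Set.left_mem_Icc.2 hτ) ht ht.1
    simp only at this
    linarith
  have hd : ∀ s ∈ Set.Icc 0 τ,
      HasDerivAt (fun s ↦ s * y₁ 0 + s ^ 2 * (m / 2) - y s) (y₁ 0 + s * m - y₁ s) s := by
    intro s hs
    have := (((hasDerivAt_id s).mul_const (y₁ 0)).add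
      (((hasDerivAt_id s).pow 2).mul_const (m / 2))).sub (h₁ s hs)
    refine this.congr_deriv ?_
    simp; ring
  have hmono : MonotoneOn (fun s ↦ s * y₁ 0 + s ^ 2 * (m / 2) - y s) (Set.Icc 0 τ) := by
    refine monotoneOn_of_deriv_nonneg (convex_Icc _ _)
      (fun s hs ↦ (hd s hs).continuousAt.continuousWithinAt)
      (fun s hs ↦ (hd s (interior_subset hs)).differentiableAt.differentiableWithinAt) ?_
    intro s hs
    rw [(hd s (interior_subset hs)).deriv]
    linarith [hI s (interior_subset hs)]
  have := hmono (Set.left_mem_Icc.2 hτ) (Set.right_mem_Icc.2 hτ) hτ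
  simp only at this
  linarith

/-- Second-order Taylor upper bound in `τ`, uniform over a compact set of parameters. -/
theorem eventually_le_taylor_two_of_isCompact {X : Type*} [NormedAddCommGroup X] [NormedSpace ℝ X]
    {Y : ℝ × X → ℝ} {K : Set X} (hK : IsCompact K)
    (hY : ∀ x ∈ K, ContDiffAt ℝ 2 Y (0, x)) {η : ℝ} (hη : 0 < η) :
    ∀ᶠ τ in 𝓝[≥] (0 : ℝ), ∀ x ∈ K, Y (τ, x) ≤ Y (0, x) + τ * deriv (fun t ↦ Y (t, x)) 0
      + τ ^ 2 * (deriv (deriv (fun t ↦ Y (t, x))) 0 / 2 + η) := by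
  set Y₁ : ℝ × X → ℝ := fun q ↦ fderiv ℝ Y q (1, 0) with hY₁
  set Y₂ : ℝ × X → ℝ := fun q ↦ fderiv ℝ Y₁ q (1, 0) with hY₂
  have c1 : ∀ q, ContDiffAt ℝ 2 Y q → ContDiffAt ℝ 1 Y₁ q := fun q hq ↦
    (hq.fderiv_right (m := 1) (by norm_num)).clm_apply contDiffAt_const
  have c2 : ∀ q, ContDiffAt ℝ 2 Y q → ContinuousAt Y₂ q := fun q hq ↦
    (((c1 q hq).fderiv_right (m := 0) (by norm_num)).clm_apply contDiffAt_const).continuousAt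
  have d1 : ∀ t x, ContDiffAt ℝ 2 Y (t, x) → HasDerivAt (fun s ↦ Y (s, x)) (Y₁ (t, x)) t := by
    intro t x h
    have hc : HasDerivAt (fun s : ℝ ↦ (s, x)) ((1 : ℝ), (0 : X)) t :=
      (hasDerivAt_id t).prodMk (hasDerivAt_const t x)
    exact (h.differentiableAt (by norm_num)).hasFDerivAt.comp_hasDerivAt t hc
  have d2 : ∀ t x, ContDiffAt ℝ 2 Y (t, x) → HasDerivAt (fun s ↦ Y₁ (s, x)) (Y₂ (t, x)) t := by
    intro t x h
    have hc : HasDerivAt (fun s : ℝ ↦ (s, x)) ((1 : ℝ), (0 : X)) t :=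
      (hasDerivAt_id t).prodMk (hasDerivAt_const t x)
    exact ((c1 _ h).differentiableAt (by norm_num)).hasFDerivAt.comp_hasDerivAt t hc
  -- Compactness of `K` makes the admissible interval in `t` independent of `x`. The excess `2 * η`
  -- becomes `η` after the factor `1 / 2` of Taylor's formula.
  have key : ∀ᶠ t in 𝓝 (0 : ℝ), ∀ x ∈ K, ContDiffAt ℝ 2 Y (t, x) ∧ Y₂ (t, x) < Y₂ (0, x) + 2 * η := by
    refine hK.eventually_forall_of_forall_eventually
      (P := fun t x ↦ ContDiffAt ℝ 2 Y (t, x) ∧ Y₂ (t, x) < Y₂ (0, x) + 2 * η) ?_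
    intro x hx
    have h := hY x hx
    have e1 : ∀ᶠ q in 𝓝 ((0 : ℝ), x), ContDiffAt ℝ 2 Y q := h.eventually (by simp)
    have hc0 : ContinuousAt (fun q : ℝ × X ↦ Y₂ (0, q.2)) ((0 : ℝ), x) := by
      have : ContinuousAt Y₂ ((fun q : ℝ × X ↦ ((0 : ℝ), q.2)) ((0 : ℝ), x)) := c2 _ h
      exact this.comp (f := fun q : ℝ × X ↦ ((0 : ℝ), q.2)) (by fun_prop)
    have e2 : ∀ᶠ q in 𝓝 ((0 : ℝ), x), Y₂ q < Y₂ (0, q.2) + 2 * η := by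
      refine (c2 _ h).eventually_lt (hc0.add continuousAt_const) ?_
      linarith
    exact e1.and e2
  obtain ⟨ε, hε, hball⟩ := Metric.eventually_nhds_iff.1 key
  have : ∀ᶠ τ in 𝓝[≥] (0 : ℝ), 0 ≤ τ ∧ τ < ε := by
    refine (eventually_mem_nhdsWithin.and (eventually_nhdsWithin_of_eventually_nhds
      (eventually_lt_nhds hε))).mono fun τ h ↦ ⟨h.1, h.2⟩
  filter_upwards [this] with τ hτ x hx
  have hmem : ∀ t ∈ Set.Icc 0 τ, dist t 0 < ε := by
    intro t ht
    rw [Real.dist_eq, sub_zero, abs_of_nonneg ht.1]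
    exact ht.2.trans_lt hτ.2
  have A := le_taylor_two hτ.1 (fun t ht ↦ d1 t x (hball (hmem t ht) x hx).1)
    (fun t ht ↦ d2 t x (hball (hmem t ht) x hx).1)
    (fun t ht ↦ (hball (hmem t ht) x hx).2.le)
  have h0 := hY x hx
  have E1 : deriv (fun t ↦ Y (t, x)) 0 = Y₁ (0, x) := (d1 0 x h0).deriv
  have E2 : deriv (deriv (fun t ↦ Y (t, x))) 0 = Y₂ (0, x) := by
    have : deriv (fun t ↦ Y (t, x)) =ᶠ[𝓝 0] fun t ↦ Y₁ (t, x) := by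
      filter_upwards [key] with t ht using (d1 t x (ht x hx).1).deriv
    rw [this.deriv_eq]
    exact (d2 0 x h0).deriv
  rw [E1, E2]
  have : (Y₂ (0, x) + 2 * η) / 2 = Y₂ (0, x) / 2 + η := by ring
  rw [this] at A
  exact A

/-- First and second derivatives of a `C²` function along a curve. -/
theorem deriv_comp_two {G : ℂ → ℝ} {c c₁ : ℝ → ℂ} {c₂ : ℂ} (hG : ContDiffAt ℝ 2 G (c 0))
    (h₁ : ∀ᶠ t in 𝓝 (0 : ℝ), HasDerivAt c (c₁ t) t) (h₂ : HasDerivAt c₁ c₂ 0) :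
    (∀ᶠ t in 𝓝 (0 : ℝ), HasDerivAt (fun t ↦ G (c t)) (fderiv ℝ G (c t) (c₁ t)) t) ∧
    HasDerivAt (fun t ↦ fderiv ℝ G (c t) (c₁ t))
      (fderiv ℝ (fderiv ℝ G) (c 0) (c₁ 0) (c₁ 0) + fderiv ℝ G (c 0) c₂) 0 := by
  constructor
  · have hc : ContinuousAt c 0 := h₁.self_of_nhds.continuousAt
    have := hc.eventually (hG.eventually (by simp))
    filter_upwards [this, h₁] with t ht h1
    exact (ht.differentiableAt (by norm_num)).hasFDerivAt.comp_hasDerivAt t h1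
  · have hd : HasFDerivAt (fderiv ℝ G) (fderiv ℝ (fderiv ℝ G) (c 0)) (c 0) :=
      ((hG.fderiv_right (m := 1) (by norm_num)).differentiableAt (by norm_num)).hasFDerivAt
    have := (hd.comp_hasDerivAt 0 h₁.self_of_nhds).clm_apply h₂
    exact this

theorem laplacian_eq_fderiv_fderiv (G : ℂ → ℝ) (z : ℂ) :
    Δ G z = fderiv ℝ (fderiv ℝ G) z 1 1 + fderiv ℝ (fderiv ℝ G) z Complex.I Complex.I := by
  rw [InnerProductSpace.laplacian_eq_iteratedFDeriv_complexPlane]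
  simp [iteratedFDeriv_two_apply]

theorem fderiv_fderiv_apply_symm {G : ℂ → ℝ} {z : ℂ} (hG : ContDiffAt ℝ 2 G z) (v w : ℂ) :
    fderiv ℝ (fderiv ℝ G) z v w = fderiv ℝ (fderiv ℝ G) z w v :=
  (hG.isSymmSndFDerivAt (by simp)).eq v w

/-- The trace of the Hessian in the rotated frame `v, i v`. -/
theorem fderiv_fderiv_add_rotate {G : ℂ → ℝ} {z : ℂ} (hG : ContDiffAt ℝ 2 G z) (v : ℂ) :
    fderiv ℝ (fderiv ℝ G) z v v + fderiv ℝ (fderiv ℝ G) z (v * Complex.I) (v * Complex.I)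
      = ‖v‖ ^ 2 * Δ G z := by
  set B := fderiv ℝ (fderiv ℝ G) z
  have hs : B Complex.I 1 = B 1 Complex.I := fderiv_fderiv_apply_symm hG _ _
  have h1 : v = v.re • (1 : ℂ) + v.im • Complex.I := by
    simp [Complex.re_add_im]
  have h2 : v * Complex.I = (-v.im) • (1 : ℂ) + v.re • Complex.I := by
    apply Complex.ext <;> simp
  have key : ∀ a b : ℝ, B (a • (1 : ℂ) + b • Complex.I) (a • (1 : ℂ) + b • Complex.I)
      = a ^ 2 * B 1 1 + 2 * a * b * B 1 Complex.I + b ^ 2 * B Complex.I Complex.I := by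
    intro a b
    simp only [map_add, map_smul, add_apply, smul_apply, smul_eq_mul, hs]
    ring
  have e1 := key v.re v.im
  rw [← h1] at e1
  rw [laplacian_eq_fderiv_fderiv, h2, key, e1, Complex.sq_norm, Complex.normSq_apply]
  ring

open Complex in
/-- The sum of the values of a function at four points of a circle, seen along the radius:
the first derivative vanishes, the second derivative is the Laplacian. -/
theorem deriv_sum_four {G : ℂ → ℝ} {f : ℂ → ℂ} (hf : AnalyticAt ℂ f 0)
    (hG : ContDiffAt ℝ 2 G (f 0)) :
    deriv (fun τ : ℝ ↦ ∑ j : Fin 4, G (f (τ * I ^ (j : ℕ)))) 0 = 0 ∧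
    deriv (deriv (fun τ : ℝ ↦ ∑ j : Fin 4, G (f (τ * I ^ (j : ℕ))))) 0
      = 2 * ‖deriv f 0‖ ^ 2 * Δ G (f 0) := by
  have main : ∀ e : ℂ,
      (∀ᶠ t : ℝ in 𝓝 (0 : ℝ), HasDerivAt (fun t : ℝ ↦ G (f (t * e)))
        (fderiv ℝ G (f (t * e)) (deriv f (t * e) * e)) t) ∧
      HasDerivAt (fun t : ℝ ↦ fderiv ℝ G (f (t * e)) (deriv f (t * e) * e))
        (fderiv ℝ (fderiv ℝ G) (f 0) (deriv f 0 * e) (deriv f 0 * e)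
          + fderiv ℝ G (f 0) (deriv (deriv f) 0 * e * e)) 0 := by
    intro e
    have hl : ∀ t : ℝ, HasDerivAt (fun t : ℝ ↦ (t : ℂ) * e) e t := fun t ↦ by
      simpa using (Complex.ofRealCLM.hasDerivAt (x := t)).mul_const e
    have hl0 : Tendsto (fun t : ℝ ↦ (t : ℂ) * e) (𝓝 0) (𝓝 0) := by
      have := (hl 0).continuousAt.tendsto
      simpa using this
    have h1 : ∀ᶠ t : ℝ in 𝓝 (0 : ℝ), HasDerivAt (fun t : ℝ ↦ f (t * e)) (deriv f (t * e) * e) t := by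
      filter_upwards [hl0.eventually hf.eventually_analyticAt] with t ht
      exact ht.differentiableAt.hasDerivAt.comp t (hl t)
    have h2 : HasDerivAt (fun t : ℝ ↦ deriv f (t * e) * e) (deriv (deriv f) 0 * e * e) 0 := by
      have hd : HasDerivAt (deriv f) (deriv (deriv f) 0) (((0 : ℝ) : ℂ) * e) := by
        simpa using hf.deriv.differentiableAt.hasDerivAt
      exact (hd.comp (0 : ℝ) (hl 0)).mul_const e
    have := deriv_comp_two (G := G) (c := fun t : ℝ ↦ f (t * e)) (by simpa using hG) h1 h2
    simpa using this
  have hd1 : ∀ᶠ t : ℝ in 𝓝 (0 : ℝ), HasDerivAt (fun τ : ℝ ↦ ∑ j : Fin 4, G (f (τ * I ^ (j : ℕ))))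
      (∑ j : Fin 4, fderiv ℝ G (f (t * I ^ (j : ℕ))) (deriv f (t * I ^ (j : ℕ)) * I ^ (j : ℕ))) t := by
    have : ∀ᶠ t : ℝ in 𝓝 (0 : ℝ), ∀ j : Fin 4, HasDerivAt (fun t : ℝ ↦ G (f (t * I ^ (j : ℕ))))
        (fderiv ℝ G (f (t * I ^ (j : ℕ))) (deriv f (t * I ^ (j : ℕ)) * I ^ (j : ℕ))) t :=
      eventually_all.2 fun j ↦ (main _).1
    filter_upwards [this] with t ht
    exact HasDerivAt.fun_sum fun j _ ↦ ht j
  constructor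
  · rw [hd1.self_of_nhds.deriv]
    simp [Fin.sum_univ_four, I_pow_three]
  · have : deriv (fun τ : ℝ ↦ ∑ j : Fin 4, G (f (τ * I ^ (j : ℕ)))) =ᶠ[𝓝 0] _ :=
      hd1.mono fun t ht ↦ ht.deriv
    rw [this.deriv_eq, (HasDerivAt.fun_sum fun (j : Fin 4) _ ↦ (main (I ^ (j : ℕ))).2).deriv]
    -- Opposite directions repeat the same Hessian value, so the trace in the frame `f'`, `i f'`
    -- appears twice. The terms with `f''` carry `(i^j)²`, which sums to zero over four points; two
    -- opposite points would not cancel them.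
    have hr := fderiv_fderiv_add_rotate hG (deriv f 0)
    rw [mul_assoc, ← hr]
    simp [Fin.sum_univ_four, I_pow_three, mul_assoc]
    ring

end WangSurface

end

/-! ### Second variation of the energy density of a conformal metric. -/

noncomputable section

namespace WangSurface

open Complex

/-- The Wirtinger derivative `∂L/∂z = (L_x - i L_y) / 2` of a real function. -/
def wirtinger (L : ℂ → ℝ) (z : ℂ) : ℂ :=
  ⟨fderiv ℝ L z 1 / 2, -(fderiv ℝ L z I) / 2⟩

theorem fderiv_eq_wirtinger (L : ℂ → ℝ) (z ξ : ℂ) :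
    fderiv ℝ L z ξ = 2 * (wirtinger L z * ξ).re := by
  have h1 : ξ = ξ.re • (1 : ℂ) + ξ.im • I := by simp [re_add_im]
  conv_lhs => rw [h1]
  simp only [map_add, map_smul, smul_eq_mul, wirtinger, mul_re]
  ring

theorem normSq_add_mul_ofReal (p w : ℂ) (t : ℝ) :
    ‖p + w * t‖ ^ 2 = ‖p‖ ^ 2 + 2 * t * (p.re * w.re + p.im * w.im) + t ^ 2 * ‖w‖ ^ 2 := by
  simp only [Complex.sq_norm, normSq_apply, add_re, add_im, mul_re, mul_im, ofReal_re, ofReal_im]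
  ring

/-- Second directional derivative of `exp (L (z + V ζ)) * ‖p + W ζ‖ ^ 2` at `ζ = 0`. -/
theorem fderiv_fderiv_energy {L : ℂ → ℝ} {z : ℂ} (hL : ContDiffAt ℝ 2 L z) (p V W e : ℂ) :
    fderiv ℝ (fderiv ℝ fun ζ ↦ Real.exp (L (z + V * ζ)) * ‖p + W * ζ‖ ^ 2) 0 e e
      = Real.exp (L z) * ((fderiv ℝ (fderiv ℝ L) z (V * e) (V * e)
        + fderiv ℝ L z (V * e) ^ 2) * ‖p‖ ^ 2
        + 4 * fderiv ℝ L z (V * e) * (p.re * (W * e).re + p.im * (W * e).im)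
        + 2 * ‖W * e‖ ^ 2) := by
  set G : ℂ → ℝ := fun ζ ↦ Real.exp (L (z + V * ζ)) * ‖p + W * ζ‖ ^ 2 with hGdef
  have hG : ContDiffAt ℝ 2 G 0 := by
    have h1 : ContDiffAt ℝ 2 (fun ζ : ℂ ↦ L (z + V * ζ)) 0 := by
      have : ContDiffAt ℝ 2 L (z + V * 0) := by simpa using hL
      exact this.comp (0 : ℂ) (f := fun ζ : ℂ ↦ z + V * ζ) (by fun_prop)
    have h2 : ContDiff ℝ 2 (fun ζ : ℂ ↦ ‖p + W * ζ‖ ^ 2) :=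
      (contDiff_const.add (contDiff_const.mul contDiff_id)).norm_sq ℝ
    exact h1.exp.mul h2.contDiffAt
  have hlin : ∀ a b : ℂ, ∀ t : ℝ, HasDerivAt (fun t : ℝ ↦ a + b * t) b t := fun a b t ↦ by
    simpa using ((Complex.ofRealCLM.hasDerivAt (x := t)).const_mul b).const_add a
  have A := deriv_comp_two (G := G) (c := fun t : ℝ ↦ 0 + e * t) (c₁ := fun _ ↦ e) (c₂ := 0)
    (by simpa using hG) (Eventually.of_forall (hlin 0 e)) (hasDerivAt_const _ _)
  have B := deriv_comp_two (G := L) (c := fun t : ℝ ↦ z + V * e * t) (c₁ := fun _ ↦ V * e)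
    (c₂ := 0) (by simpa using hL) (Eventually.of_forall (hlin z (V * e))) (hasDerivAt_const _ _)
  set l : ℝ → ℝ := fun t ↦ L (z + V * e * t)
  set l₁ : ℝ → ℝ := fun t ↦ fderiv ℝ L (z + V * e * t) (V * e)
  set n : ℝ → ℝ := fun t ↦ ‖p‖ ^ 2 + 2 * t * (p.re * (W * e).re + p.im * (W * e).im)
    + t ^ 2 * ‖W * e‖ ^ 2
  set n₁ : ℝ → ℝ := fun t ↦ 2 * (p.re * (W * e).re + p.im * (W * e).im) + 2 * t * ‖W * e‖ ^ 2
  have hn : ∀ t, HasDerivAt n (n₁ t) t := by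
    intro t
    have := ((((hasDerivAt_id t).const_mul 2).mul_const
      (p.re * (W * e).re + p.im * (W * e).im)).const_add (‖p‖ ^ 2)).add
      (((hasDerivAt_id t).pow 2).mul_const (‖W * e‖ ^ 2))
    exact this.congr_deriv (by simp [n₁])
  have hn1 : HasDerivAt n₁ (2 * ‖W * e‖ ^ 2) 0 := by
    have := (((hasDerivAt_id (0 : ℝ)).const_mul 2).mul_const (‖W * e‖ ^ 2)).const_add
      (2 * (p.re * (W * e).re + p.im * (W * e).im))
    exact this.congr_deriv (by simp)
  have hGe : ∀ t : ℝ, G (0 + e * t) = Real.exp (l t) * n t := by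
    intro t
    have : p + W * (0 + e * t) = p + W * e * t := by ring
    simp only [hGdef, l, n, this, normSq_add_mul_ofReal]
    congr 3; ring
  -- The first derivative along the line `e * t` is computed both by the chain rule for `G` and by
  -- the product rule; as the two agree near `0`, their derivatives at `0` agree.
  have h1 : ∀ᶠ t : ℝ in 𝓝 0, fderiv ℝ G (0 + e * t) e
      = Real.exp (l t) * l₁ t * n t + Real.exp (l t) * n₁ t := by
    filter_upwards [A.1, B.1] with t hA hB
    have := (hB.exp.mul (hn t))
    refine hA.unique (this.congr_of_eventuallyEq (Eventually.of_forall fun s ↦ ?_))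
    simpa using hGe s
  have h2 := A.2.congr_of_eventuallyEq (h1.mono fun t ht ↦ ht.symm)
  have hB0 := B.1.self_of_nhds
  have h3 := ((hB0.exp.mul B.2).mul (hn 0)).add (hB0.exp.mul hn1)
  have h4 := h2.unique h3
  simp only [ofReal_zero, mul_zero, add_zero, map_zero] at h4
  rw [h4]
  have e0 : l 0 = L z := by simp [l]
  have e1 : l₁ 0 = fderiv ℝ L z (V * e) := by simp [l₁]
  simp only [n, n₁, Pi.mul_apply, e0, e1, mul_zero, zero_mul]
  ring

/-- The Laplacian of `exp (L (z + V ζ)) * ‖p + W ζ‖ ^ 2` at `ζ = 0`. -/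
theorem laplacian_energy {L : ℂ → ℝ} {z : ℂ} (hL : ContDiffAt ℝ 2 L z) (p V W : ℂ) :
    Δ (fun ζ ↦ Real.exp (L (z + V * ζ)) * ‖p + W * ζ‖ ^ 2) 0
      = Real.exp (L z) * (Δ L z * ‖V‖ ^ 2 * ‖p‖ ^ 2 + 4 * ‖W + wirtinger L z * V * p‖ ^ 2) := by
  rw [laplacian_eq_fderiv_fderiv, fderiv_fderiv_energy hL, fderiv_fderiv_energy hL, mul_one,
    mul_one]
  -- The Hessian of `L` contributes its trace in the frame `V`, `i V`. The remaining terms complete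
  -- the square of `W + ∂L V p`, where `∂L V p` is the connection term of the Levi-Civita derivative
  -- of `exp L |dz|²`.
  have h := fderiv_fderiv_add_rotate hL V
  have h' : fderiv ℝ (fderiv ℝ L) z V V
      = ‖V‖ ^ 2 * Δ L z - fderiv ℝ (fderiv ℝ L) z (V * I) (V * I) := by linarith
  rw [h']
  simp only [fderiv_eq_wirtinger L z]
  generalize wirtinger L z = a
  have e1 : (a * (V * I)).re = -(a * V).im := by simp; ring
  have e2 : a * V * p = (a * V) * p := rfl
  rw [e1, e2]
  generalize a * V = b
  simp only [Complex.sq_norm, normSq_apply, add_re, add_im, mul_re, mul_im, I_re, I_im]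
  ring

/-- Four-point energy estimate, uniform over compact sets of base points and bounded vectors. -/
theorem eventually_sum_energy_le {L : ℂ → ℝ} {K : Set ℂ} (hK : IsCompact K)
    (hL : ∀ z ∈ K, ContDiffAt ℝ 2 L z) {f : ℂ → ℂ} (hf : AnalyticAt ℂ f 0) (hf0 : f 0 = 0)
    (hf1 : deriv f 0 = 1) (M : ℝ) {η : ℝ} (hη : 0 < η) :
    ∀ᶠ τ : ℝ in 𝓝[≥] (0 : ℝ), ∀ z ∈ K, ∀ p V W : ℂ, ‖p‖ ≤ M → ‖V‖ ≤ M → ‖W‖ ≤ M →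
      ∑ j : Fin 4, Real.exp (L (z + V * f (τ * I ^ (j : ℕ)))) * ‖p + W * f (τ * I ^ (j : ℕ))‖ ^ 2
        ≤ 4 * (Real.exp (L z) * ‖p‖ ^ 2)
          + τ ^ 2 * (Real.exp (L z) * (Δ L z * ‖V‖ ^ 2 * ‖p‖ ^ 2
            + 4 * ‖W + wirtinger L z * V * p‖ ^ 2) + η) := by
  -- The vectors `p`, `V`, `W` are treated as parameters in a closed ball beside `z ∈ K`, so that
  -- one threshold for `τ` serves all of them.
  set Y : ℝ × (ℂ × ℂ × ℂ × ℂ) → ℝ := fun q ↦ ∑ j : Fin 4,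
    Real.exp (L (q.2.1 + q.2.2.2.1 * f (q.1 * I ^ (j : ℕ))))
      * ‖q.2.2.1 + q.2.2.2.2 * f (q.1 * I ^ (j : ℕ))‖ ^ 2 with hYdef
  set B := Metric.closedBall (0 : ℂ) M
  have hB : IsCompact B := isCompact_closedBall _ _
  have hY : ∀ x ∈ K ×ˢ (B ×ˢ (B ×ˢ B)), ContDiffAt ℝ 2 Y (0, x) := by
    rintro ⟨z, p, V, W⟩ ⟨hz, -⟩
    refine ContDiffAt.sum fun j _ ↦ ?_
    have hfj : ContDiffAt ℝ 2 (fun q : ℝ × (ℂ × ℂ × ℂ × ℂ) ↦ f (q.1 * I ^ (j : ℕ)))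
        (0, (z, p, V, W)) := by
      have h0 : ContDiffAt ℝ 2 f ((((0 : ℝ), (z, p, V, W)) : ℝ × (ℂ × ℂ × ℂ × ℂ)).1
          * I ^ (j : ℕ)) := by
        simpa using (hf.contDiffAt (n := 2)).restrict_scalars ℝ
      refine h0.comp (f := fun q : ℝ × (ℂ × ℂ × ℂ × ℂ) ↦ (q.1 : ℂ) * I ^ (j : ℕ)) _ ?_
      exact (Complex.ofRealCLM.contDiff.comp contDiff_fst).contDiffAt.mul contDiffAt_const
    have h1 : ContDiffAt ℝ 2 (fun q : ℝ × (ℂ × ℂ × ℂ × ℂ) ↦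
        L (q.2.1 + q.2.2.2.1 * f (q.1 * I ^ (j : ℕ)))) (0, (z, p, V, W)) := by
      have h0 : ContDiffAt ℝ 2 L (((fun q : ℝ × (ℂ × ℂ × ℂ × ℂ) ↦
          q.2.1 + q.2.2.2.1 * f (q.1 * I ^ (j : ℕ)))) (0, (z, p, V, W))) := by
        simpa [hf0] using hL z hz
      refine h0.comp (f := fun q : ℝ × (ℂ × ℂ × ℂ × ℂ) ↦
          q.2.1 + q.2.2.2.1 * f (q.1 * I ^ (j : ℕ))) _ ?_
      exact ContDiffAt.add (by fun_prop) (ContDiffAt.mul (by fun_prop) hfj)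
    refine h1.exp.mul (ContDiffAt.norm_sq ℝ ?_)
    exact ContDiffAt.add (by fun_prop) (ContDiffAt.mul (by fun_prop) hfj)
  filter_upwards [eventually_le_taylor_two_of_isCompact (hK.prod (hB.prod (hB.prod hB))) hY hη]
    with τ hτ z hz p V W hp hV hW
  have h := hτ (z, p, V, W) ⟨hz, by simpa [B] using hp, by simpa [B] using hV,
    by simpa [B] using hW⟩
  set G : ℂ → ℝ := fun ζ ↦ Real.exp (L (z + V * ζ)) * ‖p + W * ζ‖ ^ 2 with hGdef
  have hG : ContDiffAt ℝ 2 G (f 0) := by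
    have h1 : ContDiffAt ℝ 2 (fun ζ : ℂ ↦ L (z + V * ζ)) (f 0) := by
      have : ContDiffAt ℝ 2 L (z + V * f 0) := by simpa [hf0] using hL z hz
      exact this.comp (f 0) (f := fun ζ : ℂ ↦ z + V * ζ) (by fun_prop)
    have h2 : ContDiff ℝ 2 (fun ζ : ℂ ↦ ‖p + W * ζ‖ ^ 2) :=
      (contDiff_const.add (contDiff_const.mul contDiff_id)).norm_sq ℝ
    exact h1.exp.mul h2.contDiffAt
  have hd := deriv_sum_four hf hG
  have e : (fun t ↦ Y (t, (z, p, V, W))) = fun τ : ℝ ↦ ∑ j : Fin 4, G (f (τ * I ^ (j : ℕ))) := rfl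
  rw [e, hd.1, hd.2, hf0, hf1, laplacian_energy (hL z hz)] at h
  simp only [hYdef, hf0, ofReal_zero, zero_mul, mul_zero, add_zero, Finset.sum_const,
    Finset.card_univ, Fintype.card_fin, norm_one, one_pow, mul_one, nsmul_eq_mul,
    Nat.cast_ofNat] at h
  refine h.trans (le_of_eq ?_)
  ring

end WangSurface

end

/-! ### Curves, arclength and nearly parallel frames. -/

noncomputable section

namespace WangSurface

open Complex Set

/-- `c` is a `C¹` curve on `[0, 1]` with derivative `c'`. -/
structure IsC1Curve (c c' : ℝ → ℂ) : Prop where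
  hasDeriv : ∀ t ∈ Icc (0 : ℝ) 1, HasDerivWithinAt c (c' t) (Icc 0 1) t
  continuousOn : ContinuousOn c' (Icc 0 1)

theorem IsC1Curve.continuousOn_self {c c' : ℝ → ℂ} (h : IsC1Curve c c') :
    ContinuousOn c (Icc 0 1) := fun t ht ↦ (h.hasDeriv t ht).continuousWithinAt

/-- The speed of a curve for the conformal metric `exp L |dz|²`. -/
def confSpeed (L : ℂ → ℝ) (c c' : ℝ → ℂ) (t : ℝ) : ℝ := Real.exp (L (c t) / 2) * ‖c' t‖

/-- The length of a curve for the conformal metric `exp L |dz|²`. -/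
def confLength (L : ℂ → ℝ) (c c' : ℝ → ℂ) : ℝ := ∫ t in (0 : ℝ)..1, confSpeed L c c' t

theorem confSpeed_nonneg (L : ℂ → ℝ) (c c' : ℝ → ℂ) (t : ℝ) : 0 ≤ confSpeed L c c' t := by
  unfold confSpeed; positivity

theorem IsC1Curve.continuousOn_confSpeed {L : ℂ → ℝ} {c c' : ℝ → ℂ} (h : IsC1Curve c c')
    (hL : ∀ t ∈ Icc (0 : ℝ) 1, ContinuousAt L (c t)) :
    ContinuousOn (confSpeed L c c') (Icc 0 1) := by
  have hLc : ContinuousOn (fun t ↦ L (c t)) (Icc 0 1) := fun t ht ↦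
    (hL t ht).comp_continuousWithinAt (h.continuousOn_self t ht)
  exact (hLc.div_const 2).rexp.mul h.continuousOn.norm

theorem IsC1Curve.intervalIntegrable_confSpeed {L : ℂ → ℝ} {c c' : ℝ → ℂ} (h : IsC1Curve c c')
    (hL : ∀ t ∈ Icc (0 : ℝ) 1, ContinuousAt L (c t)) :
    IntervalIntegrable (confSpeed L c c') MeasureTheory.volume 0 1 :=
  ContinuousOn.intervalIntegrable (by simpa using h.continuousOn_confSpeed hL)

/-- A unit frame for the metric `exp L |dz|²`, almost parallel where `∂L/∂z` is close to `a`. -/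
def frame (L : ℂ → ℝ) (a z : ℂ) : ℂ := exp (((-(L z) / 2 : ℝ) : ℂ) - ((a * z).im : ℝ) * I)

theorem norm_frame (L : ℂ → ℝ) (a z : ℂ) : ‖frame L a z‖ = Real.exp (-(L z) / 2) := by
  rw [frame, Complex.norm_exp]
  simp

/-- Adding the connection term `∂L v` to the logarithmic derivative found here leaves `i Im ((∂L -
a) v)`, small when `∂L` is close to `a`. This is why the phase of the frame is `-Im (a z)`. -/
theorem hasDerivWithinAt_frame {L : ℂ → ℝ} (a : ℂ) {c : ℝ → ℂ} {v : ℂ} {s : Set ℝ} {t : ℝ}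
    (hc : HasDerivWithinAt c v s t) (hL : DifferentiableAt ℝ L (c t)) :
    HasDerivWithinAt (fun t ↦ frame L a (c t))
      (frame L a (c t) * (-((wirtinger L (c t) * v).re : ℂ) - ((a * v).im : ℂ) * I)) s t := by
  have h1 : HasDerivWithinAt (fun t ↦ L (c t)) (2 * (wirtinger L (c t) * v).re) s t := by
    rw [← fderiv_eq_wirtinger]
    exact hL.hasFDerivAt.comp_hasDerivWithinAt t hc
  have h2 : HasDerivWithinAt (fun t ↦ (a * c t).im) (a * v).im s t :=
    Complex.imCLM.hasFDerivAt.comp_hasDerivWithinAt t (hc.const_mul a)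
  have h3 := (((h1.neg.div_const 2).ofReal_comp).sub (h2.ofReal_comp.mul_const I)).cexp
  refine h3.congr_deriv ?_
  simp only [frame, Pi.neg_apply]
  congr 2
  push_cast
  ring

theorem exists_arclength {s : ℝ → ℝ} (hs : ContinuousOn s (Icc 0 1))
    (hs0 : ∀ t ∈ Icc (0 : ℝ) 1, 0 ≤ s t) :
    ∃ l : ℝ → ℝ, l 0 = 0 ∧ l 1 = ∫ t in (0 : ℝ)..1, s t ∧
      (∀ t ∈ Icc (0 : ℝ) 1, HasDerivWithinAt l (s t) (Icc 0 1) t) ∧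
      ∀ t ∈ Icc (0 : ℝ) 1, 0 ≤ l t ∧ l t ≤ l 1 := by
  -- Extending `s` by its endpoint values makes it continuous on the line, so the fundamental
  -- theorem of calculus applies at `0` and `1` as well.
  set σ : ℝ → ℝ := fun t ↦ s (projIcc 0 1 zero_le_one t) with hσ
  have hc : Continuous σ :=
    hs.comp_continuous (continuous_subtype_val.comp continuous_projIcc) fun t ↦ (projIcc _ _ _ t).2
  have hσs : ∀ t ∈ Icc (0 : ℝ) 1, σ t = s t := fun t ht ↦ by simp [hσ, projIcc_of_mem _ ht]
  have hσ0 : ∀ t, 0 ≤ σ t := fun t ↦ hs0 _ (projIcc _ _ _ t).2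
  refine ⟨fun t ↦ ∫ x in (0 : ℝ)..t, σ x, by simp, ?_, ?_, ?_⟩
  · refine intervalIntegral.integral_congr fun t ht ↦ hσs t (by simpa using ht)
  · intro t ht
    rw [← hσs t ht]
    exact (intervalIntegral.integral_hasDerivAt_right (hc.intervalIntegrable _ _)
      (hc.stronglyMeasurableAtFilter _ _) hc.continuousAt).hasDerivWithinAt
  · intro t ht
    refine ⟨intervalIntegral.integral_nonneg ht.1 fun x _ ↦ hσ0 x, ?_⟩
    beta_reduce
    rw [← intervalIntegral.integral_add_adjacent_intervals (hc.intervalIntegrable 0 t)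
      (hc.intervalIntegrable t 1)]
    have := intervalIntegral.integral_nonneg (μ := MeasureTheory.volume) ht.2 fun x _ ↦ hσ0 x
    linarith

/-- The covariant derivative of `g • frame` is controlled. -/
theorem exp_mul_covariant_sq_le {l g k : ℝ} {α a p E u : ℂ} (hE : ‖E‖ = Real.exp (-l / 2))
    (hp : ‖p‖ = Real.exp (-l / 2)) (hu : ‖u‖ = 1) (hα : ‖α - a‖ ≤ Real.exp (l / 2)) :
    Real.exp l * ‖(k + g * (-((α * p).re : ℂ) - ((a * p).im : ℂ) * I)) * E * u
      + α * (g * E * u) * p‖ ^ 2 ≤ k ^ 2 + g ^ 2 := by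
  -- The real part of `α p` cancels, and what survives is purely imaginary relative to the frame. It
  -- is orthogonal to the contribution of `k`, so the squares add.
  have e1 : (k + g * (-((α * p).re : ℂ) - ((a * p).im : ℂ) * I)) * E * u + α * (g * E * u) * p
      = ((k : ℂ) + ((g * ((α - a) * p).im : ℝ) : ℂ) * I) * E * u := by
    have : α * p = ((α * p).re : ℂ) + ((α * p).im : ℂ) * I := (re_add_im _).symm
    have h2 : ((α - a) * p).im = (α * p).im - (a * p).im := by rw [sub_mul, sub_im]
    rw [h2]
    push_cast
    linear_combination (g * E * u) * this
  have e2 : ‖(k : ℂ) + ((g * ((α - a) * p).im : ℝ) : ℂ) * I‖ ^ 2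
      = k ^ 2 + (g * ((α - a) * p).im) ^ 2 := by
    rw [Complex.sq_norm, normSq_add_mul_I]
  have h1 : |((α - a) * p).im| ≤ 1 := by
    refine (abs_im_le_norm _).trans ?_
    rw [norm_mul, hp]
    refine (mul_le_mul_of_nonneg_right hα (Real.exp_pos _).le).trans (le_of_eq ?_)
    rw [← Real.exp_add]
    simp [neg_div]
  have h3 : Real.exp l * Real.exp (-l / 2) ^ 2 = 1 := by
    rw [← Real.exp_nat_mul, ← Real.exp_add]
    simp; ring
  rw [e1, norm_mul, norm_mul, hu, hE, mul_one, mul_pow, e2]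
  have h4 : (g * ((α - a) * p).im) ^ 2 ≤ g ^ 2 := by
    rw [mul_pow]
    have : ((α - a) * p).im ^ 2 ≤ 1 := by rw [← sq_abs]; exact pow_le_one₀ (abs_nonneg _) h1
    nlinarith [sq_nonneg g]
  calc _ = (k ^ 2 + (g * ((α - a) * p).im) ^ 2) * (Real.exp l * Real.exp (-l / 2) ^ 2) := by ring
    _ ≤ _ := by rw [h3]; linarith

end WangSurface

end

/-! ### Speed of the four displaced curves. -/

noncomputable section

namespace WangSurface

open Complex Set

/-- Four-point speed estimate for a vector field `g • frame` along a curve in a region where the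
frame is almost parallel and the curvature of `exp L |dz|²` is at least `-1`. -/
theorem eventually_sum_speed_le {L : ℂ → ℝ} {K : Set ℂ} (hK : IsCompact K)
    (hL : ∀ z ∈ K, ContDiffAt ℝ 2 L z) {a : ℂ}
    (ha : ∀ z ∈ K, ‖wirtinger L z - a‖ ≤ Real.exp (L z / 2))
    (hΔ : ∀ z ∈ K, Δ L z ≤ 2 * Real.exp (L z))
    {f : ℂ → ℂ} (hf : AnalyticAt ℂ f 0) (hf0 : f 0 = 0) (hf1 : deriv f 0 = 1)
    (N : ℝ) {r : ℝ} (hr : 0 < r) {η : ℝ} (hη : 0 < η) :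
    ∀ᶠ τ : ℝ in 𝓝[≥] (0 : ℝ), ∀ z ∈ K, ∀ v u : ℂ, ∀ g k : ℝ, ‖u‖ = 1 → 0 ≤ g → g ≤ N → |k| ≤ N →
      (∀ j : Fin 4, ‖(g * frame L a z * u) * f (τ * I ^ (j : ℕ))‖ < r) ∧
      ∑ j : Fin 4, Real.exp (L (z + g * frame L a z * u * f (τ * I ^ (j : ℕ))) / 2)
        * ‖v + (k * (Real.exp (L z / 2) * ‖v‖ : ℝ)
          + g * (-((wirtinger L z * v).re : ℂ) - ((a * v).im : ℂ) * I)) * frame L a z * u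
            * f (τ * I ^ (j : ℕ))‖
        ≤ 4 * (Real.exp (L z / 2) * ‖v‖) * (1 + τ ^ 2 * (2 * N ^ 2 + η)) := by
  have hLc : ContinuousOn L K := fun z hz ↦ (hL z hz).continuousAt.continuousWithinAt
  obtain ⟨m, hm⟩ : ∃ m, ∀ z ∈ K, Real.exp (-(L z) / 2) ≤ m := by
    have hc : ContinuousOn (fun z ↦ Real.exp (-(L z) / 2)) K := (hLc.neg.div_const 2).rexp
    obtain ⟨m, hm⟩ := (hK.image_of_continuousOn hc).bddAbove
    exact ⟨m, fun z hz ↦ hm ⟨z, hz, rfl⟩⟩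
  -- One bound for three vectors: the displacement `V`, the unit tangent `p`, and the derivative `W`
  -- of `V` per unit length, for which `|∂L p| ≤ |a| m + 1` in the good region.
  set M := max (|N| * |m|) (max |m| ((|N| + |N| * ((‖a‖ * |m| + 1) + ‖a‖ * |m|)) * |m|)) with hM
  have hsmall : ∀ᶠ τ : ℝ in 𝓝[≥] (0 : ℝ), ∀ j : Fin 4, M * ‖f (τ * I ^ (j : ℕ))‖ < r := by
    refine eventually_all.2 fun j ↦ eventually_nhdsWithin_of_eventually_nhds ?_
    have hc : ContinuousAt (fun τ : ℝ ↦ M * ‖f (τ * I ^ (j : ℕ))‖) 0 := by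
      have : ContinuousAt f (((0 : ℝ) : ℂ) * I ^ (j : ℕ)) := by simpa using hf.continuousAt
      exact continuousAt_const.mul (this.comp (f := fun τ : ℝ ↦ (τ : ℂ) * I ^ (j : ℕ))
        (by fun_prop)).norm
    exact hc.eventually_lt continuousAt_const (by simpa [hf0] using hr)
  filter_upwards [hsmall, eventually_sum_energy_le hK hL hf hf0 hf1 M hη] with τ hτ₁ hτ₂ z hz v u g
    k hu hg hgN hk
  set E := frame L a z with hE
  set α := wirtinger L z
  have hN0 : 0 ≤ N := hg.trans hgN
  have hm0 : 0 ≤ m := (Real.exp_pos _).le.trans (hm z hz)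
  have hEn : ‖E‖ = Real.exp (-(L z) / 2) := norm_frame _ _ _
  have hEm : ‖E‖ ≤ m := hEn ▸ hm z hz
  rw [abs_of_nonneg hN0, abs_of_nonneg hm0] at hM
  have hV : ‖g * E * u‖ ≤ M := by
    rw [norm_mul, norm_mul, hu, mul_one, norm_real, Real.norm_of_nonneg hg, hM]
    exact (mul_le_mul hgN hEm (norm_nonneg _) hN0).trans (le_max_left _ _)
  refine ⟨fun j ↦ ?_, ?_⟩
  · rw [norm_mul]
    exact (mul_le_mul_of_nonneg_right hV (norm_nonneg _)).trans_lt (hτ₁ j)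
  set s := Real.exp (L z / 2) * ‖v‖ with hs
  have hs0 : 0 ≤ s := by positivity
  -- Both sides are homogeneous in `v`, so a nonzero `v` may be divided by its speed. This makes the
  -- estimate uniform although `v` is unbounded.
  rcases hs0.eq_or_lt with h0 | hspos
  · have hv : v = 0 := by
      have := mul_eq_zero.1 (hs ▸ h0.symm)
      exact norm_eq_zero.1 (this.resolve_left (Real.exp_pos _).ne')
    simp [hv, ← h0]
  set p : ℂ := v / (s : ℂ) with hpdef
  have hsC : (s : ℂ) ≠ 0 := by exact_mod_cast hspos.ne'
  have hvp : v = s * p := by rw [hpdef]; field_simp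
  have hexp : Real.exp (-(L z) / 2) * Real.exp (L z / 2) = 1 := by
    rw [← Real.exp_add]; simp [neg_div]
  have hp : ‖p‖ = Real.exp (-(L z) / 2) := by
    have hvn : ‖v‖ = s * ‖p‖ := by
      conv_lhs => rw [hvp]
      rw [norm_mul, norm_real, Real.norm_of_nonneg hs0]
    have hvpos : Real.exp (L z / 2) * ‖p‖ = 1 := by
      have : s * (Real.exp (L z / 2) * ‖p‖) = s * 1 := by
        rw [mul_one]; nth_rewrite 2 [hs]; rw [hvn]; ring
      exact mul_left_cancel₀ hspos.ne' this
    calc ‖p‖ = (Real.exp (-(L z) / 2) * Real.exp (L z / 2)) * ‖p‖ := by rw [hexp, one_mul]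
      _ = Real.exp (-(L z) / 2) * (Real.exp (L z / 2) * ‖p‖) := by ring
      _ = _ := by rw [hvpos, mul_one]
  have hpm : ‖p‖ ≤ m := hp ▸ hm z hz
  set W : ℂ := (k + g * (-((α * p).re : ℂ) - ((a * p).im : ℂ) * I)) * E * u with hW
  have hWM : ‖W‖ ≤ M := by
    have hαp : ‖α * p‖ ≤ ‖a‖ * m + 1 := by
      have : α * p = a * p + (α - a) * p := by ring
      rw [this]
      refine (norm_add_le _ _).trans (add_le_add ?_ ?_)
      · rw [norm_mul]; gcongr
      · rw [norm_mul, hp, ← hexp, mul_comm (Real.exp (-(L z) / 2))]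
        exact mul_le_mul_of_nonneg_right (ha z hz) (Real.exp_pos _).le
    have hap : ‖a * p‖ ≤ ‖a‖ * m := by rw [norm_mul]; gcongr
    have h1 : ‖(-((α * p).re : ℂ) - ((a * p).im : ℂ) * I)‖ ≤ (‖a‖ * m + 1) + ‖a‖ * m := by
      refine (norm_sub_le _ _).trans (add_le_add ?_ ?_)
      · rw [norm_neg, norm_real]; exact (abs_re_le_norm _).trans hαp
      · rw [norm_mul, norm_I, mul_one, norm_real]; exact (abs_im_le_norm _).trans hap
    rw [hW, norm_mul, norm_mul, hu, mul_one]
    rw [hM]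
    refine le_trans ?_ ((le_max_right _ _).trans (le_max_right _ _))
    refine mul_le_mul ?_ hEm (norm_nonneg _) (by positivity)
    refine (norm_add_le _ _).trans (add_le_add ?_ ?_)
    · rwa [norm_real]
    · rw [norm_mul, norm_real, Real.norm_of_nonneg hg]
      exact mul_le_mul hgN h1 (norm_nonneg _) hN0
  have hmM : m ≤ M := by rw [hM]; exact (le_max_left _ _).trans (le_max_right _ _)
  have hEn' := hτ₂ z hz p (g * E * u) W (hpm.trans hmM) hV hWM
  have e1 : Real.exp (L z) * ‖p‖ ^ 2 = 1 := by
    rw [hp, ← Real.exp_nat_mul, ← Real.exp_add]; simp; ring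
  have e2 : Real.exp (L z) * ‖W + α * (g * E * u) * p‖ ^ 2 ≤ k ^ 2 + g ^ 2 :=
    exp_mul_covariant_sq_le hEn hp hu (ha z hz)
  have hVn : Real.exp (L z) * ‖g * E * u‖ ^ 2 = g ^ 2 := by
    rw [norm_mul, norm_mul, hu, mul_one, norm_real, Real.norm_of_nonneg hg, hEn, ← hp, mul_pow]
    calc _ = g ^ 2 * (Real.exp (L z) * ‖p‖ ^ 2) := by ring
      _ = _ := by rw [e1, mul_one]
  have e3 : Real.exp (L z) * (Δ L z * ‖g * E * u‖ ^ 2 * ‖p‖ ^ 2) ≤ 2 * g ^ 2 := by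
    calc _ = Δ L z * ‖g * E * u‖ ^ 2 * (Real.exp (L z) * ‖p‖ ^ 2) := by ring
      _ = Δ L z * ‖g * E * u‖ ^ 2 := by rw [e1, mul_one]
      _ ≤ 2 * Real.exp (L z) * ‖g * E * u‖ ^ 2 := by
          exact mul_le_mul_of_nonneg_right (hΔ z hz) (sq_nonneg _)
      _ = 2 * (Real.exp (L z) * ‖g * E * u‖ ^ 2) := by ring
      _ = _ := by rw [hVn]
  have hk2 : k ^ 2 ≤ N ^ 2 := sq_le_sq' (abs_le.1 hk).1 (abs_le.1 hk).2
  have hg2 : g ^ 2 ≤ N ^ 2 := pow_le_pow_left₀ hg hgN 2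
  -- The constant `10` is `2` from curvature at least `-1` plus `4 * 2` from `4 (k² + g²)`.
  have hsum : ∑ j : Fin 4, Real.exp (L (z + g * E * u * f (τ * I ^ (j : ℕ))))
      * ‖p + W * f (τ * I ^ (j : ℕ))‖ ^ 2 ≤ 4 + τ ^ 2 * (10 * N ^ 2 + η) := by
    refine hEn'.trans ?_
    rw [e1]
    have : τ ^ 2 * (Real.exp (L z) * (Δ L z * ‖g * E * u‖ ^ 2 * ‖p‖ ^ 2
        + 4 * ‖W + α * (g * E * u) * p‖ ^ 2) + η) ≤ τ ^ 2 * (10 * N ^ 2 + η) := by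
      refine mul_le_mul_of_nonneg_left ?_ (sq_nonneg _)
      linarith
    linarith
  -- Energy controls speed through `2 x ≤ 1 + x²`, an equality for the undisplaced unit vector.
  have hterm : ∀ j : Fin 4, Real.exp (L (z + g * E * u * f (τ * I ^ (j : ℕ))) / 2)
        * ‖v + (k * (s : ℝ) + g * (-((α * v).re : ℂ) - ((a * v).im : ℂ) * I)) * E * u
            * f (τ * I ^ (j : ℕ))‖
      ≤ s * ((1 + Real.exp (L (z + g * E * u * f (τ * I ^ (j : ℕ))))
      * ‖p + W * f (τ * I ^ (j : ℕ))‖ ^ 2) / 2) := by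
    intro j
    have h1 : v + (k * (s : ℝ) + g * (-((α * v).re : ℂ) - ((a * v).im : ℂ) * I)) * E * u
            * f (τ * I ^ (j : ℕ)) = s * (p + W * f (τ * I ^ (j : ℕ))) := by
      have r1 : (α * v).re = s * (α * p).re := by
        rw [hvp, mul_left_comm, re_ofReal_mul]
      have r2 : (a * v).im = s * (a * p).im := by
        rw [hvp, mul_left_comm, im_ofReal_mul]
      rw [r1, r2, hW]
      nth_rewrite 1 [hvp]
      push_cast
      ring
    rw [h1, norm_mul, norm_real, Real.norm_of_nonneg hs0]
    set y := L (z + g * E * u * f (τ * I ^ (j : ℕ)))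
    have h2 : Real.exp y = Real.exp (y / 2) ^ 2 := by
      rw [← Real.exp_nat_mul]; congr 1; push_cast; ring
    rw [h2, ← mul_pow]
    nlinarith [sq_nonneg (1 - Real.exp (y / 2) * ‖p + W * f (τ * I ^ (j : ℕ))‖)]
  refine (Finset.sum_le_sum fun j _ ↦ hterm j).trans ?_
  rw [← Finset.mul_sum, ← Finset.sum_div, Finset.sum_add_distrib]
  simp only [Finset.sum_const, Finset.card_univ, Fintype.card_fin, nsmul_eq_mul, mul_one,
    Nat.cast_ofNat]
  have : s * ((4 + ∑ j : Fin 4, Real.exp (L (z + g * E * u * f (τ * I ^ (j : ℕ))))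
      * ‖p + W * f (τ * I ^ (j : ℕ))‖ ^ 2) / 2) ≤ s * ((4 + (4 + τ ^ 2 * (10 * N ^ 2 + η))) / 2) := by
    gcongr
  refine this.trans ?_
  -- The estimates give `5 N² + η / 2` against the claimed `8 N² + 4 η`; this is twice the slack.
  have : 0 ≤ s * τ ^ 2 * (6 * N ^ 2 + 7 * η) := by positivity
  nlinarith

end WangSurface

end

/-! ### Second variation of length. -/

noncomputable section

namespace WangSurface

open Complex Set

/-- Second-variation estimate. A `C¹` curve in a good region can be displaced holomorphically,
with prescribed displacement at the endpoints, so that the four-point average of the lengths is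
controlled to second order, uniformly in the curve. -/
theorem eventually_exists_variation {L : ℂ → ℝ} {K Ω : Set ℂ} (hK : IsCompact K) (hΩ : IsOpen Ω)
    (hKΩ : K ⊆ Ω) (hL : ∀ z ∈ Ω, ContDiffAt ℝ 2 L z) {a : ℂ}
    (ha : ∀ z ∈ K, ‖wirtinger L z - a‖ ≤ Real.exp (L z / 2))
    (hΔ : ∀ z ∈ K, Δ L z ≤ 2 * Real.exp (L z))
    {f : ℂ → ℂ} (hf : AnalyticAt ℂ f 0) (hf0 : f 0 = 0) (hf1 : deriv f 0 = 1)
    {N gx gy d : ℝ} (hgx : gx ∈ Icc 0 N) (hgy : gy ∈ Icc 0 N) (hd : 0 < d)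
    (hgd : |gy - gx| ≤ d * N) {u : ℂ} (hu : ‖u‖ = 1) {η : ℝ} (hη : 0 < η) :
    ∀ᶠ τ : ℝ in 𝓝[≥] (0 : ℝ), ∀ c c' : ℝ → ℂ, IsC1Curve c c' → (∀ t ∈ Icc (0 : ℝ) 1, c t ∈ K) →
      d ≤ confLength L c c' →
      ∃ C C' : Fin 4 → ℝ → ℂ, (∀ j, IsC1Curve (C j) (C' j)) ∧
        (∀ j, ∀ t ∈ Icc (0 : ℝ) 1, C j t ∈ Ω) ∧
        (∀ j, C j 0 = c 0 + gx * frame L a (c 0) * u * f (τ * I ^ (j : ℕ))) ∧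
        (∀ j, C j 1 = c 1 + gy * frame L a (c 1) * u * f (τ * I ^ (j : ℕ))) ∧
        ∑ j, confLength L (C j) (C' j) ≤ 4 * confLength L c c' * (1 + τ ^ 2 * (2 * N ^ 2 + η)) := by
  obtain ⟨r, hr, hrΩ⟩ := hK.exists_thickening_subset_open hΩ hKΩ
  filter_upwards [eventually_sum_speed_le hK (fun z hz ↦ hL z (hKΩ hz)) ha hΔ hf hf0 hf1 N hr hη]
    with τ hτ c c' hc hcK hlen
  have hLc : ∀ t ∈ Icc (0 : ℝ) 1, ContinuousAt L (c t) := fun t ht ↦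
    (hL _ (hKΩ (hcK t ht))).continuousAt
  set ℓ := confLength L c c' with hℓ
  have hℓ0 : 0 < ℓ := hd.trans_le hlen
  obtain ⟨l, hl0, hl1, hld, hlm⟩ := exists_arclength (hc.continuousOn_confSpeed hLc)
    fun t _ ↦ confSpeed_nonneg _ _ _ _
  have hl1' : l 1 = ℓ := hl1
  -- The weight is affine in arclength, hence its slope `k` is constant. It satisfies `|k| ≤ N`
  -- because `|gy - gx| ≤ d N` and the curve has length at least `d`.
  set k := (gy - gx) / ℓ with hk
  set g : ℝ → ℝ := fun t ↦ gx + k * l t with hg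
  have hkN : |k| ≤ N := by
    rw [hk, abs_div, abs_of_pos hℓ0, div_le_iff₀ hℓ0]
    have hN : 0 ≤ N := hgx.1.trans hgx.2
    nlinarith
  have hgt : ∀ t ∈ Icc (0 : ℝ) 1, g t ∈ Icc 0 N := by
    intro t ht
    have h1 : 0 ≤ l t / ℓ := div_nonneg (hlm t ht).1 hℓ0.le
    have h2 : l t / ℓ ≤ 1 := (div_le_one hℓ0).2 (hl1' ▸ (hlm t ht).2)
    have h3 : g t = (1 - l t / ℓ) * gx + (l t / ℓ) * gy := by
      simp only [hg, hk]; field_simp; ring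
    rw [h3]
    exact convex_Icc 0 N hgx hgy (by linarith) h1 (by ring)
  have hgd : ∀ t ∈ Icc (0 : ℝ) 1, HasDerivWithinAt g (k * confSpeed L c c' t) (Icc 0 1) t :=
    fun t ht ↦ ((hld t ht).const_mul k).const_add gx
  set V : ℝ → ℂ := fun t ↦ g t * frame L a (c t) * u with hV
  set V' : ℝ → ℂ := fun t ↦ (k * (confSpeed L c c' t : ℝ)
    + g t * (-((wirtinger L (c t) * c' t).re : ℂ) - ((a * c' t).im : ℂ) * I))
      * frame L a (c t) * u with hV'
  have hVd : ∀ t ∈ Icc (0 : ℝ) 1, HasDerivWithinAt V (V' t) (Icc 0 1) t := by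
    intro t ht
    have h1 := hasDerivWithinAt_frame a (hc.hasDeriv t ht)
      ((hL _ (hKΩ (hcK t ht))).differentiableAt (by norm_num))
    refine (((hgd t ht).ofReal_comp.mul h1).mul_const u).congr_deriv ?_
    simp only [hV']
    push_cast
    ring
  have hcc : ContinuousOn c (Icc 0 1) := hc.continuousOn_self
  have hwc : ContinuousOn (fun t ↦ wirtinger L (c t)) (Icc 0 1) := by
    have hfd : ContinuousOn (fun t ↦ fderiv ℝ L (c t)) (Icc 0 1) := fun t ht ↦
      ((hL _ (hKΩ (hcK t ht))).fderiv_right (m := 1) (by norm_num)).continuousAt.comp_continuousWithinAt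
        (hcc t ht)
    have : (fun t ↦ wirtinger L (c t)) = fun t ↦ ((fderiv ℝ L (c t) 1 / 2 : ℝ) : ℂ)
        + ((-(fderiv ℝ L (c t) I) / 2 : ℝ) : ℂ) * I := by
      funext t
      simp [wirtinger, Complex.mk_eq_add_mul_I]
    rw [this]
    have h1 : ContinuousOn (fun t ↦ fderiv ℝ L (c t) 1) (Icc 0 1) := hfd.clm_apply continuousOn_const
    have h2 : ContinuousOn (fun t ↦ fderiv ℝ L (c t) I) (Icc 0 1) := hfd.clm_apply continuousOn_const
    exact (continuous_ofReal.comp_continuousOn (h1.div_const 2)).add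
      ((continuous_ofReal.comp_continuousOn (h2.neg.div_const 2)).mul continuousOn_const)
  have hV'c : ContinuousOn V' (Icc 0 1) := by
    have hgc : ContinuousOn (fun t ↦ (g t : ℂ)) (Icc 0 1) :=
      continuous_ofReal.comp_continuousOn fun t ht ↦ (hgd t ht).continuousWithinAt
    have hfc : ContinuousOn (fun t ↦ frame L a (c t)) (Icc 0 1) := fun t ht ↦
      (hasDerivWithinAt_frame a (hc.hasDeriv t ht)
        ((hL _ (hKΩ (hcK t ht))).differentiableAt (by norm_num))).continuousWithinAt
    have hsc : ContinuousOn (fun t ↦ (confSpeed L c c' t : ℂ)) (Icc 0 1) :=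
      continuous_ofReal.comp_continuousOn (hc.continuousOn_confSpeed hLc)
    have h1 : ContinuousOn (fun t ↦ ((wirtinger L (c t) * c' t).re : ℂ)) (Icc 0 1) :=
      (continuous_ofReal.comp continuous_re).comp_continuousOn (hwc.mul hc.continuousOn)
    have h2 : ContinuousOn (fun t ↦ ((a * c' t).im : ℂ)) (Icc 0 1) :=
      (continuous_ofReal.comp continuous_im).comp_continuousOn (continuousOn_const.mul hc.continuousOn)
    exact (((continuousOn_const.mul hsc).add (hgc.mul (h1.neg.sub (h2.mul continuousOn_const)))).mul
      hfc).mul continuousOn_const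
  set F : Fin 4 → ℂ := fun j ↦ f (τ * I ^ (j : ℕ)) with hF
  have hC1 : ∀ j, IsC1Curve (fun t ↦ c t + V t * F j) (fun t ↦ c' t + V' t * F j) := fun j ↦
    ⟨fun t ht ↦ (hc.hasDeriv t ht).add ((hVd t ht).mul_const _),
      hc.continuousOn.add (hV'c.mul continuousOn_const)⟩
  have hCΩ : ∀ j, ∀ t ∈ Icc (0 : ℝ) 1, c t + V t * F j ∈ Ω := by
    intro j t ht
    have h := (hτ (c t) (hcK t ht) (c' t) u (g t) k hu (hgt t ht).1 (hgt t ht).2 hkN).1 j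
    refine hrΩ (Metric.mem_thickening_iff.2 ⟨c t, hcK t ht, ?_⟩)
    simpa [dist_eq_norm, hV, hF] using h
  have hint : ∀ j, IntervalIntegrable
      (confSpeed L (fun t ↦ c t + V t * F j) (fun t ↦ c' t + V' t * F j))
      MeasureTheory.volume 0 1 := fun j ↦
    (hC1 j).intervalIntegrable_confSpeed fun t ht ↦ (hL _ (hCΩ j t ht)).continuousAt
  refine ⟨fun j t ↦ c t + V t * F j, fun j t ↦ c' t + V' t * F j, hC1, hCΩ, fun j ↦ ?_, fun j ↦ ?_,
    ?_⟩
  · simp [hV, hg, hl0, hF]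
  · have : g 1 = gy := by simp only [hg, hk, hl1']; field_simp; ring
    simp only [hV, this, hF]
  · simp only [confLength]
    rw [← intervalIntegral.integral_finsetSum fun j _ ↦ hint j]
    have e : 4 * ℓ * (1 + τ ^ 2 * (2 * N ^ 2 + η))
        = ∫ t in (0 : ℝ)..1, 4 * confSpeed L c c' t * (1 + τ ^ 2 * (2 * N ^ 2 + η)) := by
      rw [intervalIntegral.integral_mul_const, intervalIntegral.integral_const_mul]
      rfl
    rw [e]
    refine intervalIntegral.integral_mono_on zero_le_one
      (by simpa only [Finset.sum_fn] using IntervalIntegrable.sum Finset.univ fun j _ ↦ hint j)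
      (((hc.intervalIntegrable_confSpeed hLc).const_mul 4).mul_const _) fun t ht ↦ ?_
    exact (hτ (c t) (hcK t ht) (c' t) u (g t) k hu (hgt t ht).1 (hgt t ht).2 hkN).2

end WangSurface

end

/-! ### Hopf–Rinow for complete locally compact length spaces. -/

noncomputable section

namespace WangSurface

open Metric

/-- Approximate intermediate points exist: the extended distance is a length distance. -/
def HasIntermediatePoints (X : Type*) [PseudoEMetricSpace X] : Prop :=
  ∀ x y : X, ∀ a b : ℝ, 0 < a → 0 < b → edist x y < ENNReal.ofReal (a + b) →
    ∃ z, edist x z < ENNReal.ofReal a ∧ edist z y < ENNReal.ofReal b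

variable {X : Type*} [PseudoEMetricSpace X]

theorem isCompact_closedEBall_mono {o : X} {R R' : ℝ}
    (h : IsCompact (closedEBall o (ENNReal.ofReal R))) (hR : R' ≤ R) :
    IsCompact (closedEBall o (ENNReal.ofReal R')) :=
  h.of_isClosed_subset isClosed_closedEBall
    (closedEBall_subset_closedEBall (ENNReal.ofReal_le_ofReal hR))

/-- A compact neighbourhood of the ball contains its `δ`-thickening for some `δ`. Intermediate
points place every point at distance less than `R + δ` in that thickening. -/
theorem HasIntermediatePoints.exists_isCompact_gt [WeaklyLocallyCompactSpace X]
    (hX : HasIntermediatePoints X) {o : X} {R : ℝ} (hR : 0 < R)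
    (h : IsCompact (closedEBall o (ENNReal.ofReal R))) :
    ∃ R' > R, IsCompact (closedEBall o (ENNReal.ofReal R')) := by
  obtain ⟨K, hK, hBK⟩ := exists_compact_superset h
  obtain ⟨δ, hδ, hδK⟩ := h.exists_thickening_subset_open isOpen_interior hBK
  refine ⟨R + δ / 2, by linarith, hK.of_isClosed_subset isClosed_closedEBall fun y hy ↦ ?_⟩
  refine interior_subset (hδK (mem_thickening_iff_exists_edist_lt _ _ |>.2 ?_))
  have hy' : edist o y ≤ ENNReal.ofReal (R + δ / 2) := by rw [edist_comm]; exact hy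
  have hlt : edist o y < ENNReal.ofReal (R + δ) := hy'.trans_lt
    ((ENNReal.ofReal_lt_ofReal_iff (by linarith)).2 (by linarith))
  obtain ⟨z, hz1, hz2⟩ := hX o y R δ hR hδ hlt
  exact ⟨z, by rw [mem_closedEBall, edist_comm]; exact hz1.le, by rwa [edist_comm]⟩

/-- A finite `ε / 2`-net of a slightly smaller ball is an `ε`-net of the whole ball, since every
point lies within `ε / 2` of the smaller one. Completeness turns total boundedness into compactness.
-/
theorem HasIntermediatePoints.isCompact_of_lt [CompleteSpace X]
    (hX : HasIntermediatePoints X) {o : X} {R : ℝ} (hR : 0 < R)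
    (h : ∀ R' < R, IsCompact (closedEBall o (ENNReal.ofReal R'))) :
    IsCompact (closedEBall o (ENNReal.ofReal R)) := by
  refine isCompact_iff_totallyBounded_isComplete.2
    ⟨EMetric.totallyBounded_iff.2 fun ε hε ↦ ?_, isClosed_closedEBall.isComplete⟩
  obtain ⟨b, -, hb0, hbε⟩ := ENNReal.lt_iff_exists_real_btwn.1 (ENNReal.half_pos hε.ne')
  rw [ENNReal.ofReal_pos] at hb0
  set b' := min b (R / 2) with hb'
  have hb'0 : 0 < b' := lt_min hb0 (by linarith)
  have hb'R : b' ≤ R / 2 := min_le_right _ _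
  have hb'ε : ENNReal.ofReal b' ≤ ε / 2 :=
    (ENNReal.ofReal_le_ofReal (min_le_left _ _)).trans hbε.le
  obtain ⟨t, ht, htc⟩ := EMetric.totallyBounded_iff.1 (h (R - b' / 2) (by linarith)).totallyBounded
    (ε / 2) (ENNReal.half_pos hε.ne')
  refine ⟨t, ht, fun y hy ↦ ?_⟩
  have hy' : edist o y ≤ ENNReal.ofReal R := by rw [edist_comm]; exact hy
  have hlt : edist o y < ENNReal.ofReal ((R - b' / 2) + b') := hy'.trans_lt
    ((ENNReal.ofReal_lt_ofReal_iff (by linarith)).2 (by linarith))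
  obtain ⟨z, hz1, hz2⟩ := hX o y _ _ (by linarith) hb'0 hlt
  have hz : z ∈ closedEBall o (ENNReal.ofReal (R - b' / 2)) := by
    rw [mem_closedEBall, edist_comm]; exact hz1.le
  obtain ⟨w, hw, hzw⟩ := Set.mem_iUnion₂.1 (htc hz)
  refine Set.mem_iUnion₂.2 ⟨w, hw, ?_⟩
  rw [mem_eball] at hzw ⊢
  calc edist y w ≤ edist y z + edist z w := edist_triangle _ _ _
    _ < ε / 2 + ε / 2 := by
        refine ENNReal.add_lt_add ?_ hzw
        rw [edist_comm]; exact hz2.trans_le hb'ε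
    _ = ε := ENNReal.add_halves ε

/-- Hopf–Rinow: in a complete locally compact length space closed balls are compact. -/
theorem HasIntermediatePoints.isCompact_closedEBall [CompleteSpace X] [WeaklyLocallyCompactSpace X]
    (hX : HasIntermediatePoints X) (o : X) (R : ℝ) :
    IsCompact (closedEBall o (ENNReal.ofReal R)) := by
  obtain ⟨R₀, hR₀, hc₀⟩ : ∃ R₀ > 0, IsCompact (closedEBall o (ENNReal.ofReal R₀)) := by
    obtain ⟨K, hK, hoK⟩ := exists_compact_mem_nhds o
    obtain ⟨ε, hε, hεK⟩ := nhds_basis_closedEBall.mem_iff.1 hoK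
    obtain ⟨b, -, hb0, hbε⟩ := ENNReal.lt_iff_exists_real_btwn.1 hε
    rw [ENNReal.ofReal_pos] at hb0
    exact ⟨b, hb0, hK.of_isClosed_subset isClosed_closedEBall
      ((closedEBall_subset_closedEBall hbε.le).trans hεK)⟩
  by_contra hcon
  -- If some ball fails to be compact, the radii of compact balls have a finite supremum. It is
  -- attained by the limiting argument and then exceeded by the enlargement argument.
  set s := {r : ℝ | 0 < r ∧ IsCompact (closedEBall o (ENNReal.ofReal r))} with hs
  have hbdd : BddAbove s := ⟨R, fun r hr ↦ by
    by_contra hlt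
    exact hcon (isCompact_closedEBall_mono hr.2 (not_le.1 hlt).le)⟩
  have hne : s.Nonempty := ⟨R₀, hR₀, hc₀⟩
  have hpos : 0 < sSup s := hR₀.trans_le (le_csSup hbdd ⟨hR₀, hc₀⟩)
  have hsup : IsCompact (closedEBall o (ENNReal.ofReal (sSup s))) := by
    refine hX.isCompact_of_lt hpos fun r hr ↦ ?_
    obtain ⟨r', hr's, hrr'⟩ := exists_lt_of_lt_csSup hne hr
    exact isCompact_closedEBall_mono hr's.2 hrr'.le
  obtain ⟨R', hR', hcR'⟩ := hX.exists_isCompact_gt hpos hsup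
  exact absurd (le_csSup hbdd ⟨hpos.trans hR', hcR'⟩) (not_le.2 hR')

/-- Exact intermediate points exist when closed balls are compact. -/
theorem HasIntermediatePoints.exists_between (hX : HasIntermediatePoints X) {o p : X}
    (hc : ∀ R : ℝ, IsCompact (closedEBall o (ENNReal.ofReal R))) {a b : ℝ} (ha : 0 < a) (hb : 0 < b)
    (h : edist o p = ENNReal.ofReal (a + b)) :
    ∃ q, edist o q = ENNReal.ofReal a ∧ edist q p = ENNReal.ofReal b := by
  -- The point of the ball of radius `a` closest to `p` works: approximate intermediate points bound
  -- its distance to `p` by `b`, and the triangle inequality forces equality in both bounds.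
  obtain ⟨q, hq, hmin⟩ := (hc a).exists_isMinOn ⟨o, by simp⟩
    (f := fun q ↦ edist q p) (continuous_id.edist continuous_const).continuousOn
  have h1 : edist o q ≤ ENNReal.ofReal a := by rw [edist_comm]; exact hq
  have h2 : edist q p ≤ ENNReal.ofReal b := by
    refine ENNReal.le_of_forall_pos_le_add fun ε hε _ ↦ ?_
    have hε' : (0 : ℝ) < ε := hε
    obtain ⟨z, hz1, hz2⟩ := hX o p a (b + ε) ha (by positivity) (by
      rw [h]; exact (ENNReal.ofReal_lt_ofReal_iff (by positivity)).2 (by linarith))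
    have : edist q p ≤ edist z p := hmin (by rw [mem_closedEBall, edist_comm]; exact hz1.le)
    refine (this.trans hz2.le).trans (le_of_eq ?_)
    rw [ENNReal.ofReal_add hb.le hε'.le, ENNReal.ofReal_coe_nnreal]
  have htri : ENNReal.ofReal a + ENNReal.ofReal b ≤ edist o q + edist q p := by
    rw [← ENNReal.ofReal_add ha.le hb.le, ← h]; exact edist_triangle _ _ _
  refine ⟨q, le_antisymm h1 ?_, le_antisymm h2 ?_⟩
  · have := htri.trans (add_le_add_right h2 _)
    exact (ENNReal.add_le_add_iff_right ENNReal.ofReal_ne_top).1 this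
  · have := htri.trans (add_le_add_left h1 _)
    exact (ENNReal.add_le_add_iff_left ENNReal.ofReal_ne_top).1 this

end WangSurface

end

/-! ### Laplacian comparison for the distance function, in four-point form. -/

noncomputable section

namespace WangSurface

open Complex Set

/-- `𝒜` is a holomorphic atlas of the length space `X`, whose distance is that of the conformal
metric `exp (L φ z) |dz|²`, of class `C²` and of Gauss curvature at least `-1`. -/
structure IsConformalAtlas {X : Type*} [PseudoEMetricSpace X] (𝒜 : Set (OpenPartialHomeomorph X ℂ))
    (L : OpenPartialHomeomorph X ℂ → ℂ → ℝ) : Prop where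
  exists_chart (p : X) : ∃ φ ∈ 𝒜, p ∈ φ.source
  contDiffAt (φ) (hφ : φ ∈ 𝒜) (z : ℂ) (hz : z ∈ φ.target) : ContDiffAt ℝ 2 (L φ) z
  laplacian_le (φ) (hφ : φ ∈ 𝒜) (z : ℂ) (hz : z ∈ φ.target) : Δ (L φ) z ≤ 2 * Real.exp (L φ z)
  edist_le (φ) (hφ : φ ∈ 𝒜) (c c' : ℝ → ℂ) (hc : IsC1Curve c c')
    (ht : ∀ t ∈ Icc (0 : ℝ) 1, c t ∈ φ.target) :
    edist (φ.symm (c 0)) (φ.symm (c 1)) ≤ ENNReal.ofReal (confLength (L φ) c c')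
  exists_curve (φ) (hφ : φ ∈ 𝒜) (x y : X) (D : ℝ) (hD : edist x y < ENNReal.ofReal D)
    (hs : Metric.eball x (ENNReal.ofReal D) ⊆ φ.source) :
    ∃ c c' : ℝ → ℂ, IsC1Curve c c' ∧ c 0 = φ x ∧ c 1 = φ y ∧
      (∀ t ∈ Icc (0 : ℝ) 1, c t ∈ φ.target ∧ φ.symm (c t) ∈ Metric.eball x (ENNReal.ofReal D)) ∧
      confLength (L φ) c c' < D
  analyticAt (φ) (hφ : φ ∈ 𝒜) (ψ) (hψ : ψ ∈ 𝒜) (z : ℂ) (hz : z ∈ φ.target)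
    (hz' : φ.symm z ∈ ψ.source) : AnalyticAt ℂ (fun z ↦ ψ (φ.symm z)) z
  density_eq (φ) (hφ : φ ∈ 𝒜) (ψ) (hψ : ψ ∈ 𝒜) (z : ℂ) (hz : z ∈ φ.target)
    (hz' : φ.symm z ∈ ψ.source) : Real.exp (L φ z / 2)
      = Real.exp (L ψ (ψ (φ.symm z)) / 2) * ‖deriv (fun z ↦ ψ (φ.symm z)) z‖

variable {X : Type*} [PseudoEMetricSpace X] {𝒜 : Set (OpenPartialHomeomorph X ℂ)}
  {L : OpenPartialHomeomorph X ℂ → ℂ → ℝ}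

/-- The region `K` of the chart `φ` is one on which `frame (L φ) a` is almost parallel. -/
structure IsGoodRegion (L : ℂ → ℝ) (φ : OpenPartialHomeomorph X ℂ) (K : Set ℂ) (a : ℂ) : Prop where
  isCompact : IsCompact K
  subset_target : K ⊆ φ.target
  wirtinger_le : ∀ z ∈ K, ‖wirtinger L z - a‖ ≤ Real.exp (L z / 2)

theorem continuousAt_wirtinger {L : ℂ → ℝ} {z : ℂ} (h : ContDiffAt ℝ 2 L z) :
    ContinuousAt (wirtinger L) z := by
  have hfd : ContinuousAt (fun z ↦ fderiv ℝ L z) z :=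
    (h.fderiv_right (m := 1) (by norm_num)).continuousAt
  have : wirtinger L = fun z ↦ ((fderiv ℝ L z 1 / 2 : ℝ) : ℂ)
      + ((-(fderiv ℝ L z I) / 2 : ℝ) : ℂ) * I := by
    funext t
    simp [wirtinger, Complex.mk_eq_add_mul_I]
  rw [this]
  have h1 : ContinuousAt (fun z ↦ fderiv ℝ L z 1) z := hfd.clm_apply continuousAt_const
  have h2 : ContinuousAt (fun z ↦ fderiv ℝ L z I) z := hfd.clm_apply continuousAt_const
  exact (continuous_ofReal.continuousAt.comp (h1.div_const 2)).add
    ((continuous_ofReal.continuousAt.comp (h2.neg.div_const 2)).mul continuousAt_const)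

/-- With `a` the value of `∂L` at the point itself, the required bound reads `0 < exp (L / 2)`
there, and it persists nearby by continuity. -/
theorem IsConformalAtlas.exists_isGoodRegion (h : IsConformalAtlas 𝒜 L) (p : X) :
    ∃ φ ∈ 𝒜, ∃ K a, IsGoodRegion (L φ) φ K a ∧
      ∃ U : Set X, IsOpen U ∧ p ∈ U ∧ U ⊆ φ.source ∧ ∀ q ∈ U, φ q ∈ K := by
  obtain ⟨φ, hφ, hp⟩ := h.exists_chart p
  have hz := φ.map_source hp
  have hC := h.contDiffAt φ hφ _ hz
  have h1 : ∀ᶠ z in 𝓝 (φ p), ‖wirtinger (L φ) z - wirtinger (L φ) (φ p)‖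
      < Real.exp (L φ z / 2) := by
    refine ((continuousAt_wirtinger hC).sub continuousAt_const).norm.eventually_lt
      (hC.continuousAt.div_const 2).rexp ?_
    simp [Real.exp_pos]
  obtain ⟨r, hr, hball⟩ := Metric.nhds_basis_closedBall.mem_iff.1
    (h1.and (φ.open_target.mem_nhds hz))
  refine ⟨φ, hφ, Metric.closedBall (φ p) r, wirtinger (L φ) (φ p),
    ⟨isCompact_closedBall _ _, fun z hz ↦ (hball hz).2, fun z hz ↦ (hball hz).1.le⟩,
    φ.source ∩ φ ⁻¹' Metric.ball (φ p) r, φ.isOpen_inter_preimage Metric.isOpen_ball,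
    ⟨hp, Metric.mem_ball_self hr⟩, inter_subset_left, fun q hq ↦ Metric.ball_subset_closedBall hq.2⟩

/-- The variation is applied to curves of length less than `d + δ` rather than to a minimiser. The
threshold for `τ` does not depend on the curve, so `δ → 0` can be taken at fixed `τ`. -/
theorem IsConformalAtlas.eventually_sum_edist_le (h : IsConformalAtlas 𝒜 L)
    {ψ : OpenPartialHomeomorph X ℂ} (hψ : ψ ∈ 𝒜) {K : Set ℂ} {a : ℂ}
    (hK : IsGoodRegion (L ψ) ψ K a) {x y : X} {d : ℝ} (hd : 0 < d)
    (hxy : edist x y = ENNReal.ofReal d)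
    (hball : ∀ q ∈ Metric.eball x (ENNReal.ofReal (2 * d)), q ∈ ψ.source ∧ ψ q ∈ K)
    {f : ℂ → ℂ} (hf : AnalyticAt ℂ f 0) (hf0 : f 0 = 0) (hf1 : deriv f 0 = 1)
    {N gx gy : ℝ} (hgx : gx ∈ Icc 0 N) (hgy : gy ∈ Icc 0 N)
    (hgd : |gy - gx| ≤ d * N) {u : ℂ} (hu : ‖u‖ = 1) {η : ℝ} (hη : 0 < η) :
    ∀ᶠ τ : ℝ in 𝓝[≥] (0 : ℝ), ∑ j : Fin 4,
      edist (ψ.symm (ψ x + gx * frame (L ψ) a (ψ x) * u * f (τ * I ^ (j : ℕ))))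
        (ψ.symm (ψ y + gy * frame (L ψ) a (ψ y) * u * f (τ * I ^ (j : ℕ))))
      ≤ ENNReal.ofReal (4 * d * (1 + τ ^ 2 * (2 * N ^ 2 + η))) := by
  filter_upwards [eventually_exists_variation hK.isCompact ψ.open_target hK.subset_target
    (h.contDiffAt ψ hψ) hK.wirtinger_le
    (fun z hz ↦ h.laplacian_le ψ hψ z (hK.subset_target hz)) hf hf0 hf1 hgx hgy hd hgd hu hη]
    with τ hτ
  have key : ∀ δ : ℝ, 0 < δ → δ < d → ∑ j : Fin 4,
      edist (ψ.symm (ψ x + gx * frame (L ψ) a (ψ x) * u * f (τ * I ^ (j : ℕ))))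
        (ψ.symm (ψ y + gy * frame (L ψ) a (ψ y) * u * f (τ * I ^ (j : ℕ))))
      ≤ ENNReal.ofReal (4 * (d + δ) * (1 + τ ^ 2 * (2 * N ^ 2 + η))) := by
    intro δ hδ hδd
    have hsub : Metric.eball x (ENNReal.ofReal (d + δ)) ⊆ Metric.eball x (ENNReal.ofReal (2 * d)) :=
      Metric.eball_subset_eball (ENNReal.ofReal_le_ofReal (by linarith))
    have hx : x ∈ ψ.source := (hball x (Metric.mem_eball_self (by simpa using hd))).1
    have hy : y ∈ ψ.source := by
      refine (hball y ?_).1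
      rw [Metric.mem_eball, edist_comm, hxy]
      exact (ENNReal.ofReal_lt_ofReal_iff (by linarith)).2 (by linarith)
    obtain ⟨c, c', hc, hc0, hc1, hct, hlen⟩ := h.exists_curve ψ hψ x y (d + δ)
      (by rw [hxy]; exact (ENNReal.ofReal_lt_ofReal_iff (by linarith)).2 (by linarith))
      (fun q hq ↦ (hball q (hsub hq)).1)
    have hcK : ∀ t ∈ Icc (0 : ℝ) 1, c t ∈ K := by
      intro t ht
      have := (hball _ (hsub (hct t ht).2)).2
      rwa [ψ.right_inv (hct t ht).1] at this
    have hdl : d ≤ confLength (L ψ) c c' := by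
      have := h.edist_le ψ hψ c c' hc fun t ht ↦ (hct t ht).1
      rw [hc0, hc1, ψ.left_inv hx, ψ.left_inv hy, hxy] at this
      refine (ENNReal.ofReal_le_ofReal_iff'.1 this).resolve_right (not_le.2 hd)
    obtain ⟨C, C', hC, hCt, hC0, hC1, hCl⟩ := hτ c c' hc hcK hdl
    have hnn : ∀ j, 0 ≤ confLength (L ψ) (C j) (C' j) := fun j ↦
      intervalIntegral.integral_nonneg zero_le_one fun t _ ↦ confSpeed_nonneg _ _ _ _
    calc _ ≤ ∑ j : Fin 4, ENNReal.ofReal (confLength (L ψ) (C j) (C' j)) := by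
          refine Finset.sum_le_sum fun j _ ↦ ?_
          have := h.edist_le ψ hψ (C j) (C' j) (hC j) (hCt j)
          rwa [hC0, hC1, hc0, hc1] at this
      _ = ENNReal.ofReal (∑ j : Fin 4, confLength (L ψ) (C j) (C' j)) :=
          (ENNReal.ofReal_sum_of_nonneg fun j _ ↦ hnn j).symm
      _ ≤ _ := by
          refine ENNReal.ofReal_le_ofReal (hCl.trans ?_)
          have : 0 ≤ 1 + τ ^ 2 * (2 * N ^ 2 + η) := by positivity
          gcongr
  have hlim : Tendsto (fun δ : ℝ ↦ ENNReal.ofReal (4 * (d + δ) * (1 + τ ^ 2 * (2 * N ^ 2 + η))))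
      (𝓝[>] 0) (𝓝 (ENNReal.ofReal (4 * (d + 0) * (1 + τ ^ 2 * (2 * N ^ 2 + η))))) := by
    refine Tendsto.mono_left (Continuous.tendsto ?_ 0) nhdsWithin_le_nhds
    exact ENNReal.continuous_ofReal.comp (by fun_prop)
  rw [add_zero] at hlim
  refine ge_of_tendsto hlim ?_
  filter_upwards [Ioo_mem_nhdsGT hd] with δ hδ using key δ hδ.1 hδ.2

/-- The distance to `o` has, near a point at distance `ρ`, four-point averages bounded to second
order: an integrated form of the Laplacian comparison theorem. -/
def FourPointBound (𝒜 : Set (OpenPartialHomeomorph X ℂ)) (L : OpenPartialHomeomorph X ℂ → ℂ → ℝ)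
    (o p : X) (ρ : ℝ) : Prop :=
  ∀ φ ∈ 𝒜, p ∈ φ.source → ∀ f : ℂ → ℂ, AnalyticAt ℂ f 0 → f 0 = φ p →
    Real.exp (L φ (φ p) / 2) * ‖deriv f 0‖ = Real.exp ρ - 1 → ∀ η : ℝ, 0 < η →
    ∀ᶠ τ : ℝ in 𝓝[≥] (0 : ℝ), ∑ j : Fin 4, edist o (φ.symm (f (τ * I ^ (j : ℕ))))
      ≤ ENNReal.ofReal (4 * ρ + 4 * τ ^ 2 * (8 * (Real.exp (2 * ρ) - 1) + η))

theorem eventually_four_points {P : ℂ → Prop} (h : ∀ᶠ z in 𝓝 (0 : ℂ), P z) :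
    ∀ᶠ τ : ℝ in 𝓝[≥] (0 : ℝ), ∀ j : Fin 4, P (τ * I ^ (j : ℕ)) := by
  refine eventually_all.2 fun j ↦ eventually_nhdsWithin_of_eventually_nhds ?_
  have : Tendsto (fun τ : ℝ ↦ (τ : ℂ) * I ^ (j : ℕ)) (𝓝 0) (𝓝 0) := by
    have hc : Continuous fun τ : ℝ ↦ (τ : ℂ) * I ^ (j : ℕ) := by fun_prop
    simpa using hc.tendsto 0
  exact this.eventually h

/-- This lets the coefficient `8 (e^{2ρ} - 1)` absorb one link of length `d`: the gain is at least
`16 d e^{2a}` by `e^{2d} ≥ 1 + 2d`, and the cost is `2 d e^{2d} e^{2a}` with `e^{2d} ≤ 8`. -/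
theorem exp_growth {a d : ℝ} (hd : 0 ≤ d) (hd1 : d ≤ 1) :
    8 * Real.exp (2 * a) + 2 * d * Real.exp (a + d) ^ 2 ≤ 8 * Real.exp (2 * (a + d)) := by
  have h1 : Real.exp (a + d) ^ 2 = Real.exp (2 * a) * Real.exp (2 * d) := by
    rw [← Real.exp_nat_mul, ← Real.exp_add]; congr 1; push_cast; ring
  have h2 : Real.exp (2 * (a + d)) = Real.exp (2 * a) * Real.exp (2 * d) := by
    rw [← Real.exp_add]; congr 1; ring
  have h3 : 2 * d + 1 ≤ Real.exp (2 * d) := Real.add_one_le_exp _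
  have h4 : Real.exp (2 * d) ≤ 8 := by
    calc Real.exp (2 * d) ≤ Real.exp 2 := Real.exp_le_exp.2 (by linarith)
      _ = Real.exp 1 ^ 2 := by rw [← Real.exp_nat_mul]; norm_num
      _ ≤ 2.7182818286 ^ 2 := by
          exact pow_le_pow_left₀ (Real.exp_pos _).le Real.exp_one_lt_d9.le 2
      _ ≤ 8 := by norm_num
  rw [h1, h2]
  have h5 : 8 + 2 * d * Real.exp (2 * d) ≤ 8 * Real.exp (2 * d) := by nlinarith
  nlinarith [Real.exp_pos (2 * a)]

/-- A germ at `y` is transplanted to a germ at `x` through the frame, with its size rescaled from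
`e^{a+d} - 1` to `e^a - 1`. The bound at `x` controls the four distances from `o` to the
transplanted points, the link estimate controls the four distances across, and the triangle
inequality adds them. -/
theorem IsConformalAtlas.fourPointBound_step (h : IsConformalAtlas 𝒜 L)
    {ψ : OpenPartialHomeomorph X ℂ} (hψ : ψ ∈ 𝒜) {K : Set ℂ} {b : ℂ}
    (hK : IsGoodRegion (L ψ) ψ K b) {o x y : X} {a d : ℝ} (ha : 0 ≤ a) (hd : 0 < d) (hd1 : d ≤ 1)
    (hox : edist o x = ENNReal.ofReal a) (hxy : edist x y = ENNReal.ofReal d)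
    (hball : ∀ q ∈ Metric.eball x (ENNReal.ofReal (2 * d)), q ∈ ψ.source ∧ ψ q ∈ K)
    (hx : a = 0 ∨ FourPointBound 𝒜 L o x a) : FourPointBound 𝒜 L o y (a + d) := by
  intro φ hφ hyφ f hf hf0 hfn η hη
  have hxψ : x ∈ ψ.source := (hball x (Metric.mem_eball_self (by simpa using hd))).1
  have hyψ : y ∈ ψ.source := by
    refine (hball y ?_).1
    rw [Metric.mem_eball, edist_comm, hxy]
    exact (ENNReal.ofReal_lt_ofReal_iff (by linarith)).2 (by linarith)
  have hz : φ y ∈ φ.target := φ.map_source hyφ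
  have hz' : φ.symm (φ y) ∈ ψ.source := by rwa [φ.left_inv hyφ]
  have hT := h.analyticAt φ hφ ψ hψ (φ y) hz hz'
  have hdens := h.density_eq φ hφ ψ hψ (φ y) hz hz'
  rw [φ.left_inv hyφ] at hdens
  set F : ℂ → ℂ := fun ζ ↦ ψ (φ.symm (f ζ)) with hF
  have hT' : AnalyticAt ℂ (fun z ↦ ψ (φ.symm z)) (f 0) := by rwa [hf0]
  have hFa : AnalyticAt ℂ F 0 := hT'.comp hf
  have hF0 : F 0 = ψ y := by simp [hF, hf0, φ.left_inv hyφ]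
  set v := deriv F 0 with hv
  have hvd : v = deriv (fun z ↦ ψ (φ.symm z)) (φ y) * deriv f 0 := by
    have := hT'.differentiableAt.hasDerivAt.comp (0 : ℂ) hf.differentiableAt.hasDerivAt
    rw [hf0] at this
    exact this.deriv
  set gy := Real.exp (a + d) - 1 with hgy
  set gx := Real.exp a - 1 with hgx
  have hgy0 : 0 < gy := by
    have := Real.add_one_le_exp (a + d); simp only [hgy]; linarith
  have hgx0 : 0 ≤ gx := by
    have := Real.add_one_le_exp a; simp only [hgx]; linarith
  have hvn : Real.exp (L ψ (ψ y) / 2) * ‖v‖ = gy := by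
    rw [← hfn, hvd, norm_mul, ← mul_assoc, ← hdens]
  have hv0 : v ≠ 0 := by
    rintro h0
    rw [h0, norm_zero, mul_zero] at hvn
    exact hgy0.ne hvn
  set E := frame (L ψ) b (ψ y) with hE
  have hE0 : E ≠ 0 := by rw [hE, frame]; exact exp_ne_zero _
  have hgyC : (gy : ℂ) ≠ 0 := by exact_mod_cast hgy0.ne'
  -- The unit number `u` rotates the frame so that the displacement at `y` points along `F'(0)`.
  set u := v / (gy * E) with hu
  have huv : gy * E * u = v := by rw [hu]; field_simp
  have hexp : Real.exp (-(L ψ (ψ y)) / 2) * Real.exp (L ψ (ψ y) / 2) = 1 := by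
    rw [← Real.exp_add]; simp [neg_div]
  have hu1 : ‖u‖ = 1 := by
    rw [hu, norm_div, norm_mul, norm_real, Real.norm_of_nonneg hgy0.le, norm_frame, ← hvn]
    have hvp : 0 < ‖v‖ := norm_pos_iff.2 hv0
    rw [div_eq_one_iff_eq]
    · calc ‖v‖ = (Real.exp (-(L ψ (ψ y)) / 2) * Real.exp (L ψ (ψ y) / 2)) * ‖v‖ := by
            rw [hexp, one_mul]
        _ = _ := by ring
    · positivity
  -- With this normalised germ, the displaced endpoint at `y` is exactly `F`, not merely its
  -- linearisation.
  set n : ℂ → ℂ := fun ζ ↦ (F ζ - ψ y) / v with hn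
  have hna : AnalyticAt ℂ n 0 := (hFa.sub analyticAt_const).div analyticAt_const hv0
  have hn0 : n 0 = 0 := by simp [hn, hF0]
  have hn1 : deriv n 0 = 1 := by
    have := (hFa.differentiableAt.hasDerivAt.sub_const (ψ y)).div_const v
    rw [this.deriv]
    exact div_self hv0
  have hgd : |gy - gx| ≤ d * Real.exp (a + d) := by
    have e1 : gy - gx = Real.exp (a + d) - Real.exp a := by simp only [hgy, hgx]; ring
    have e2 : Real.exp a = Real.exp (a + d) * Real.exp (-d) := by
      rw [← Real.exp_add]; congr 1; ring
    have e3 : -d + 1 ≤ Real.exp (-d) := Real.add_one_le_exp _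
    have e4 : Real.exp a ≤ Real.exp (a + d) := Real.exp_le_exp.2 (by linarith)
    rw [e1, abs_of_nonneg (by linarith), e2]
    nlinarith [Real.exp_pos (a + d)]
  have hlocal := h.eventually_sum_edist_le hψ hK hd hxy hball hna hn0 hn1
    (N := Real.exp (a + d)) (gx := gx) (gy := gy)
    ⟨hgx0, by have := Real.exp_le_exp.2 (show a ≤ a + d by linarith); simp only [hgx]; linarith⟩
    ⟨hgy0.le, by simp only [hgy]; linarith⟩ hgd hu1 (η := η / 4) (by linarith)
  have hFx : ∀ᶠ τ : ℝ in 𝓝[≥] (0 : ℝ), ∑ j : Fin 4, edist o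
      (ψ.symm (ψ x + gx * frame (L ψ) b (ψ x) * u * n (τ * I ^ (j : ℕ))))
      ≤ ENNReal.ofReal (4 * a + 4 * τ ^ 2 * (8 * (Real.exp (2 * a) - 1) + η / 4)) := by
    -- At distance zero the weight `gx` vanishes, so all four transplanted points coincide with `x`.
    rcases hx with rfl | hx
    · have : gx = 0 := by simp [hgx]
      refine Eventually.of_forall fun τ ↦ ?_
      simp [this, ψ.left_inv hxψ, hox]
    · refine hx ψ hψ hxψ (fun ζ ↦ ψ x + gx * frame (L ψ) b (ψ x) * u * n ζ)
        (analyticAt_const.add (analyticAt_const.mul hna)) (by simp [hn0]) ?_ (η / 4) (by linarith)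
      have := (hna.differentiableAt.hasDerivAt.const_mul
        (gx * frame (L ψ) b (ψ x) * u)).const_add (ψ x)
      rw [this.deriv, hn1, mul_one, norm_mul, norm_mul, hu1, mul_one, norm_real,
        Real.norm_of_nonneg hgx0, norm_frame]
      have e : Real.exp (L ψ (ψ x) / 2) * Real.exp (-(L ψ (ψ x)) / 2) = 1 := by
        rw [← Real.exp_add]; simp [neg_div]
      calc _ = gx * (Real.exp (L ψ (ψ x) / 2) * Real.exp (-(L ψ (ψ x)) / 2)) := by ring
        _ = _ := by rw [e, mul_one]
  have hsrc : ∀ᶠ ζ in 𝓝 (0 : ℂ), φ.symm (f ζ) ∈ ψ.source := by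
    have hc : ContinuousAt (fun ζ ↦ φ.symm (f ζ)) 0 := by
      have : ContinuousAt φ.symm (f 0) := by rw [hf0]; exact φ.continuousAt_symm hz
      exact this.comp hf.continuousAt
    refine hc.eventually_mem (ψ.open_source.mem_nhds ?_)
    rwa [hf0]
  filter_upwards [hlocal, hFx, eventually_four_points hsrc] with τ h1 h2 h3
  have hpt : ∀ j : Fin 4, φ.symm (f (τ * I ^ (j : ℕ)))
      = ψ.symm (ψ y + gy * frame (L ψ) b (ψ y) * u * n (τ * I ^ (j : ℕ))) := by
    intro j
    have : ψ y + gy * frame (L ψ) b (ψ y) * u * n (τ * I ^ (j : ℕ)) = F (τ * I ^ (j : ℕ)) := by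
      rw [← hE, huv]; simp only [hn]; field_simp; ring
    rw [this]
    exact (ψ.left_inv (h3 j)).symm
  have hx2 : 0 ≤ Real.exp (2 * a) - 1 := by
    have := Real.add_one_le_exp (2 * a); linarith
  calc ∑ j : Fin 4, edist o (φ.symm (f (τ * I ^ (j : ℕ))))
      ≤ ∑ j : Fin 4, (edist o (ψ.symm (ψ x + gx * frame (L ψ) b (ψ x) * u * n (τ * I ^ (j : ℕ))))
        + edist (ψ.symm (ψ x + gx * frame (L ψ) b (ψ x) * u * n (τ * I ^ (j : ℕ))))
          (ψ.symm (ψ y + gy * frame (L ψ) b (ψ y) * u * n (τ * I ^ (j : ℕ))))) := by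
        refine Finset.sum_le_sum fun j _ ↦ ?_
        rw [hpt j]
        exact edist_triangle _ _ _
    _ ≤ ENNReal.ofReal (4 * a + 4 * τ ^ 2 * (8 * (Real.exp (2 * a) - 1) + η / 4))
        + ENNReal.ofReal (4 * d * (1 + τ ^ 2 * (2 * Real.exp (a + d) ^ 2 + η / 4))) := by
        rw [Finset.sum_add_distrib]
        exact add_le_add h2 h1
    _ = ENNReal.ofReal (4 * a + 4 * τ ^ 2 * (8 * (Real.exp (2 * a) - 1) + η / 4)
        + 4 * d * (1 + τ ^ 2 * (2 * Real.exp (a + d) ^ 2 + η / 4))) := by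
        refine (ENNReal.ofReal_add ?_ ?_).symm <;> positivity
    _ ≤ _ := by
        refine ENNReal.ofReal_le_ofReal ?_
        have hg := exp_growth (a := a) hd.le hd1
        have hb : 8 * (Real.exp (2 * a) - 1) + η / 4 + (2 * d * Real.exp (a + d) ^ 2 + d * (η / 4))
            ≤ 8 * (Real.exp (2 * (a + d)) - 1) + η := by nlinarith
        have := mul_le_mul_of_nonneg_left hb (show 0 ≤ 4 * τ ^ 2 by positivity)
        nlinarith

/-- Laplacian comparison for the distance function, in four-point form. -/
theorem IsConformalAtlas.fourPointBound (h : IsConformalAtlas 𝒜 L)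
    (hX : HasIntermediatePoints X)
    (hc : ∀ (o : X) (R : ℝ), IsCompact (Metric.closedEBall o (ENNReal.ofReal R)))
    {o p : X} {ρ : ℝ} (hρ : 0 < ρ) (hop : edist o p = ENNReal.ofReal ρ) :
    FourPointBound 𝒜 L o p ρ := by
  choose φ hφ K a hK U hU hpU hUs hUK using h.exists_isGoodRegion
  obtain ⟨δ, hδ, hleb⟩ := lebesgue_number_lemma_of_emetric (hc o ρ) hU
    (fun q _ ↦ mem_iUnion.2 ⟨q, hpU q⟩)
  obtain ⟨b, -, hb0, hbδ⟩ := ENNReal.lt_iff_exists_real_btwn.1 hδ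
  rw [ENNReal.ofReal_pos] at hb0
  -- The link estimate needs a ball of radius `2 d` inside one good region, hence `b / 2`; the bound
  -- `1` is for `exp_growth`.
  set s := min (b / 2) 1 with hs
  have hs0 : 0 < s := lt_min (by linarith) one_pos
  have hs1 : s ≤ 1 := min_le_right _ _
  have hsb : 2 * s ≤ b := by linarith [min_le_left (b / 2) 1]
  have step : ∀ x y : X, ∀ a d : ℝ, 0 ≤ a → 0 < d → d ≤ s → a ≤ ρ → edist o x = ENNReal.ofReal a →
      edist x y = ENNReal.ofReal d → (a = 0 ∨ FourPointBound 𝒜 L o x a) →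
      FourPointBound 𝒜 L o y (a + d) := by
    intro x y a d ha hd hds haρ hox hxy hx
    obtain ⟨i, hi⟩ := hleb x (by
      rw [Metric.mem_closedEBall, edist_comm, hox]; exact ENNReal.ofReal_le_ofReal haρ)
    refine h.fourPointBound_step (hφ i) (hK i) ha hd (hds.trans hs1) hox hxy (fun q hq ↦ ?_) hx
    have : q ∈ U i := hi (Metric.eball_subset_eball
      ((ENNReal.ofReal_le_ofReal (by linarith)).trans hbδ.le) hq)
    exact ⟨hUs i this, hUK i q this⟩
  have main : ∀ n : ℕ, ∀ q : X, ∀ r : ℝ, 0 < r → r ≤ ρ → r ≤ n * s → edist o q = ENNReal.ofReal r →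
      FourPointBound 𝒜 L o q r := by
    intro n
    induction n with
    | zero => intro q r hr _ hrn; simp at hrn; linarith
    | succ n ih =>
      intro q r hr hrρ hrn hoq
      rcases le_or_gt r s with hrs | hrs
      · have := step o q 0 r le_rfl hr hrs hρ.le (by simp) hoq (Or.inl rfl)
        rwa [zero_add] at this
      -- The last link has length exactly `s`, so the remaining distance falls by `s` and the
      -- induction on the number of links proceeds.
      · obtain ⟨x, hx1, hx2⟩ := hX.exists_between (hc o) (sub_pos.2 hrs) hs0
          (by rw [sub_add_cancel]; exact hoq)
        have := step x q (r - s) s (by linarith) hs0 le_rfl (by linarith) hx1 hx2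
          (Or.inr (ih x (r - s) (by linarith) (by linarith) (by push_cast at hrn; linarith) hx1))
        rwa [sub_add_cancel] at this
  obtain ⟨n, hn⟩ := exists_nat_ge (ρ / s)
  exact main n p ρ hρ le_rfl ((div_le_iff₀ hs0).1 hn) hop

end WangSurface

end

/-! ### Maximum principle and the Ahlfors–Schwarz–Yau lemma. -/

noncomputable section

namespace WangSurface

open Complex Set

variable {X : Type*} [PseudoEMetricSpace X] {𝒜 : Set (OpenPartialHomeomorph X ℂ)}
  {L : OpenPartialHomeomorph X ℂ → ℂ → ℝ}

/-- Four-point lower bound for a `C²` function along a holomorphic germ. -/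
theorem eventually_le_sum_four {G : ℂ → ℝ} {f : ℂ → ℂ} (hf : AnalyticAt ℂ f 0)
    (hG : ContDiffAt ℝ 2 G (f 0)) {η : ℝ} (hη : 0 < η) :
    ∀ᶠ τ : ℝ in 𝓝[≥] (0 : ℝ), 4 * G (f 0) + τ ^ 2 * (‖deriv f 0‖ ^ 2 * Δ G (f 0) - η)
      ≤ ∑ j : Fin 4, G (f (τ * I ^ (j : ℕ))) := by
  -- The lower bound is the Taylor upper bound for the negated sum, with a one-point parameter set.
  set Y : ℝ × ℝ → ℝ := fun q ↦ -∑ j : Fin 4, G (f (q.1 * I ^ (j : ℕ)))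
  have hY : ∀ x ∈ ({0} : Set ℝ), ContDiffAt ℝ 2 Y (0, x) := by
    rintro x -
    refine (ContDiffAt.sum fun j _ ↦ ?_).neg
    have hl : ContDiffAt ℝ 2 (fun q : ℝ × ℝ ↦ (q.1 : ℂ) * I ^ (j : ℕ)) (0, x) :=
      (Complex.ofRealCLM.contDiff.comp contDiff_fst).contDiffAt.mul contDiffAt_const
    have h0 : ContDiffAt ℝ 2 f (((((0 : ℝ), x) : ℝ × ℝ).1 : ℂ) * I ^ (j : ℕ)) := by
      simpa using (hf.contDiffAt (n := 2)).restrict_scalars ℝ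
    have h1 : ContDiffAt ℝ 2 (fun q : ℝ × ℝ ↦ f (q.1 * I ^ (j : ℕ))) (0, x) :=
      h0.comp (f := fun q : ℝ × ℝ ↦ (q.1 : ℂ) * I ^ (j : ℕ)) _ hl
    have h2 : ContDiffAt ℝ 2 G ((fun q : ℝ × ℝ ↦ f (q.1 * I ^ (j : ℕ))) (0, x)) := by simpa using hG
    exact h2.comp (f := fun q : ℝ × ℝ ↦ f (q.1 * I ^ (j : ℕ))) _ h1
  have hd := deriv_sum_four hf hG
  filter_upwards [eventually_le_taylor_two_of_isCompact isCompact_singleton hY hη] with τ hτ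
  have h := hτ 0 rfl
  have e1 : deriv (fun t ↦ Y (t, 0)) = fun t ↦ -deriv (fun τ : ℝ ↦ ∑ j : Fin 4,
      G (f (τ * I ^ (j : ℕ)))) t := by
    funext t; exact deriv.fun_neg
  have e2 : deriv (deriv (fun t ↦ Y (t, 0))) 0 = -deriv (deriv (fun τ : ℝ ↦ ∑ j : Fin 4,
      G (f (τ * I ^ (j : ℕ))))) 0 := by
    rw [e1]; exact deriv.fun_neg
  rw [e2, e1] at h
  beta_reduce at h
  rw [hd.1, hd.2] at h
  simp only [Y, ofReal_zero, zero_mul, Finset.sum_const, Finset.card_univ, Fintype.card_fin,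
    nsmul_eq_mul, Nat.cast_ofNat, neg_zero, mul_zero, add_zero] at h
  linarith

/-- Points close to `p` in a chart are close for the distance. -/
theorem IsConformalAtlas.eventually_edist_le (h : IsConformalAtlas 𝒜 L)
    {φ : OpenPartialHomeomorph X ℂ} (hφ : φ ∈ 𝒜) {p : X} (hp : p ∈ φ.source) (v : ℂ) :
    ∀ᶠ τ : ℝ in 𝓝[≥] (0 : ℝ), ∀ j : Fin 4, edist p (φ.symm (φ p + v * (τ * I ^ (j : ℕ))))
      ≤ ENNReal.ofReal (2 * (Real.exp (L φ (φ p) / 2) * ‖v‖) * τ) := by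
  have hz := φ.map_source hp
  have hLc := (h.contDiffAt φ hφ _ hz).continuousAt
  have h1 : ∀ᶠ z in 𝓝 (φ p), Real.exp (L φ z / 2) < 2 * Real.exp (L φ (φ p) / 2) :=
    (hLc.div_const 2).rexp.eventually_lt continuousAt_const
      (by linarith [Real.exp_pos (L φ (φ p) / 2)])
  obtain ⟨r, hr, hball⟩ := Metric.nhds_basis_ball.mem_iff.1
    (h1.and (φ.open_target.mem_nhds hz))
  have hsmall : ∀ᶠ ζ in 𝓝 (0 : ℂ), φ p + v * ζ ∈ Metric.ball (φ p) r := by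
    have : Tendsto (fun ζ ↦ φ p + v * ζ) (𝓝 0) (𝓝 (φ p)) := by
      have hc : Continuous fun ζ ↦ φ p + v * ζ := by fun_prop
      simpa using hc.tendsto 0
    exact this.eventually_mem (Metric.ball_mem_nhds _ hr)
  filter_upwards [eventually_four_points hsmall, self_mem_nhdsWithin] with τ hτ hτ0 j
  have hτ0' : 0 ≤ τ := hτ0
  set e := v * (τ * I ^ (j : ℕ)) with he
  have hen : ‖e‖ = ‖v‖ * τ := by
    rw [he, norm_mul, norm_mul, norm_pow, norm_I, one_pow, mul_one, norm_real,
      Real.norm_of_nonneg hτ0']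
  have hc : IsC1Curve (fun t ↦ φ p + e * t) (fun _ ↦ e) := by
    refine ⟨fun t _ ↦ ?_, continuousOn_const⟩
    have := ((Complex.ofRealCLM.hasDerivAt (x := t)).const_mul e).const_add (φ p)
    simpa using this.hasDerivWithinAt
  have hmem : ∀ t ∈ Icc (0 : ℝ) 1, φ p + e * t ∈ Metric.ball (φ p) r := by
    intro t ht
    have h2 : ‖e‖ < r := by
      have := hτ j
      rwa [Metric.mem_ball, dist_eq_norm, add_sub_cancel_left] at this
    rw [Metric.mem_ball, dist_eq_norm, add_sub_cancel_left, norm_mul, norm_real,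
      Real.norm_of_nonneg ht.1]
    exact (mul_le_of_le_one_right (norm_nonneg _) ht.2).trans_lt h2
  have hle := h.edist_le φ hφ _ _ hc fun t ht ↦ (hball (hmem t ht)).2
  simp only [ofReal_zero, mul_zero, add_zero, ofReal_one, mul_one, φ.left_inv hp] at hle
  refine hle.trans (ENNReal.ofReal_le_ofReal ?_)
  have hint := hc.intervalIntegrable_confSpeed (L := L φ) fun t ht ↦
    (h.contDiffAt φ hφ _ (hball (hmem t ht)).2).continuousAt
  calc confLength (L φ) (fun t ↦ φ p + e * t) (fun _ ↦ e)
      ≤ ∫ t in (0 : ℝ)..1, 2 * Real.exp (L φ (φ p) / 2) * ‖e‖ := by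
        refine intervalIntegral.integral_mono_on zero_le_one hint (by simp) fun t ht ↦ ?_
        exact mul_le_mul_of_nonneg_right (hball (hmem t ht)).1.le (norm_nonneg _)
    _ = _ := by rw [intervalIntegral.integral_const, hen]; simp; ring

theorem neg_log_one_sub_le {x : ℝ} (hx : |x| ≤ 1 / 2) : -Real.log (1 - x) ≤ x + 2 * x ^ 2 := by
  obtain ⟨h1, h2⟩ := abs_le.1 hx
  have hpos : 0 < 1 - x := by linarith
  have h3 := Real.one_sub_inv_le_log_of_pos hpos
  have h4 : (1 - x)⁻¹ ≤ 1 + x + 2 * x ^ 2 := by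
    rw [inv_le_iff_one_le_mul₀ hpos]
    nlinarith [sq_nonneg x]
  linarith

/-- Multiplied by `e^r - 1`, this bounds `r (e^{2r} - 1)` by `(2 + r) (e^r - 1)²`. So the four-point
bound times `r`, divided by the squared germ size, grows only linearly in `r`. -/
theorem mul_exp_add_one_le {r : ℝ} :
    r * (Real.exp r + 1) ≤ (2 + r) * (Real.exp r - 1) := by
  have := Real.add_one_le_exp r
  linarith

/-- The differential inequality at a point where `w + 2 log (1 - r² / R²)` is maximal. -/
theorem IsConformalAtlas.exp_le_of_isMax (h : IsConformalAtlas 𝒜 L)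
    (hX : HasIntermediatePoints X)
    (hc : ∀ (o : X) (R : ℝ), IsCompact (Metric.closedEBall o (ENNReal.ofReal R)))
    {w : X → ℝ} (hw : ∀ φ ∈ 𝒜, ∀ z ∈ φ.target, ContDiffAt ℝ 2 (fun z ↦ w (φ.symm z)) z)
    (hwΔ : ∀ φ ∈ 𝒜, ∀ z ∈ φ.target, Real.exp (L φ z) * (2 * Real.exp (w (φ.symm z)) - 2)
      ≤ Δ (fun z ↦ w (φ.symm z)) z) {o p : X} {R r ρ : ℝ} (hr : 0 ≤ r) (hrR : r < R)
    (hop : edist o p = ENNReal.ofReal r) (hρ : ρ = 1 - r ^ 2 / R ^ 2)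
    (hmax : ∀ q, ∀ s : ℝ, 0 ≤ s → s < R → edist o q = ENNReal.ofReal s →
      w q + 2 * Real.log (1 - s ^ 2 / R ^ 2) ≤ w p + 2 * Real.log ρ) :
    2 * Real.exp (w p) - 2
      ≤ 1 / R ^ 2 + (304 + 128 * R) / (R ^ 2 * ρ) + 1024 / (R ^ 2 * ρ ^ 2) := by
  obtain ⟨φ, hφ, hp⟩ := h.exists_chart p
  have hz := φ.map_source hp
  have hR : 0 < R := hr.trans_lt hrR
  have hρ0 : 0 < ρ := by
    rw [hρ, sub_pos, div_lt_one (by positivity)]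
    exact pow_lt_pow_left₀ hrR hr (by norm_num)
  -- `g` is the metric size of the germ at `p`. For `r > 0` it is prescribed by `FourPointBound`;
  -- for `r = 0` any positive value does, since the distance then enters only quadratically.
  obtain ⟨g, hg0, hg⟩ : ∃ g : ℝ, 0 < g ∧ (r = 0 ∨ (0 < r ∧ g = Real.exp r - 1)) := by
    rcases hr.eq_or_lt with h0 | h0
    · exact ⟨1, one_pos, Or.inl h0.symm⟩
    · exact ⟨Real.exp r - 1, by linarith [Real.add_one_le_exp r], Or.inr ⟨h0, rfl⟩⟩
  set v : ℂ := ((g * Real.exp (-(L φ (φ p)) / 2) : ℝ) : ℂ) with hv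
  have hvn : ‖v‖ = g * Real.exp (-(L φ (φ p)) / 2) := by
    rw [hv, norm_real, Real.norm_of_nonneg (by positivity)]
  have hexp : Real.exp (L φ (φ p) / 2) * Real.exp (-(L φ (φ p)) / 2) = 1 := by
    rw [← Real.exp_add]; simp [neg_div]
  have hvg : Real.exp (L φ (φ p) / 2) * ‖v‖ = g := by
    rw [hvn, mul_left_comm, hexp, mul_one]
  set f : ℂ → ℂ := fun ζ ↦ φ p + v * ζ with hf
  have hfa : AnalyticAt ℂ f 0 := analyticAt_const.add (analyticAt_const.mul analyticAt_id)
  have hf0 : f 0 = φ p := by simp [hf]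
  have hf1 : deriv f 0 = v := by
    have := ((hasDerivAt_id (0 : ℂ)).const_mul v).const_add (φ p)
    exact this.deriv.trans (mul_one v)
  have E1 := h.eventually_edist_le hφ hp v
  rw [hvg] at E1
  -- The error `g² / (r + 1)` is chosen so that `r` times it is at most `g²`.
  have E2 : r = 0 ∨ ∀ᶠ τ : ℝ in 𝓝[≥] (0 : ℝ), ∑ j : Fin 4, edist o (φ.symm (f (τ * I ^ (j : ℕ))))
      ≤ ENNReal.ofReal (4 * r + 4 * τ ^ 2 * (8 * (Real.exp (2 * r) - 1) + g ^ 2 / (r + 1))) := by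
    rcases hg with h0 | ⟨h0, hgr⟩
    · exact Or.inl h0
    · exact Or.inr (h.fourPointBound hX hc h0 hop φ hφ hp f hfa hf0 (by rw [hf1, hvg, hgr]) _
        (by positivity))
  have E2' : ∀ᶠ τ : ℝ in 𝓝[≥] (0 : ℝ), r = 0 ∨
      ∑ j : Fin 4, edist o (φ.symm (f (τ * I ^ (j : ℕ)))) ≤ ENNReal.ofReal
        (4 * r + 4 * τ ^ 2 * (8 * (Real.exp (2 * r) - 1) + g ^ 2 / (r + 1))) := by
    rcases E2 with h0 | h0
    · exact Eventually.of_forall fun _ ↦ Or.inl h0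
    · exact h0.mono fun _ h1 ↦ Or.inr h1
  have hG : ContDiffAt ℝ 2 (fun z ↦ w (φ.symm z)) (f 0) := by rw [hf0]; exact hw φ hφ _ hz
  have E3 := eventually_le_sum_four hfa hG (η := g ^ 2 / R ^ 2) (by positivity)
  -- The conditions keep the four points inside the ball of radius `R`, bound the squared distance
  -- changes, and make `|x j| ≤ 1 / 2` below. Here `τ > 0` is strict because `τ²` is divided out at
  -- the end.
  have E4 : ∀ᶠ τ : ℝ in 𝓝[>] (0 : ℝ), 2 * g * τ < R - r ∧ g * τ < R ∧
      8 * R * g * τ < R ^ 2 * ρ / 2 := by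
    refine eventually_nhdsWithin_of_eventually_nhds ?_
    have c1 : ∀ a b : ℝ, 0 < b → ∀ᶠ τ : ℝ in 𝓝 (0 : ℝ), a * τ < b := by
      intro a b hb
      have : ContinuousAt (fun τ : ℝ ↦ a * τ) 0 := by fun_prop
      exact this.eventually_lt continuousAt_const (by simpa using hb)
    exact (c1 _ _ (by linarith)).and ((c1 _ _ hR).and (c1 _ _ (by positivity)))
  have hle : 𝓝[>] (0 : ℝ) ≤ 𝓝[≥] 0 := nhdsWithin_mono _ Ioi_subset_Ici_self
  obtain ⟨τ, hτ1, hτ2, hτ3, ⟨hτ4, hτ5, hτ6⟩, hτ0⟩ :=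
    ((E1.filter_mono hle).and ((E2'.filter_mono hle).and
      ((E3.filter_mono hle).and (E4.and
        (self_mem_nhdsWithin : Ioi (0 : ℝ) ∈ 𝓝[>] 0))))).exists
  have hτ0 : 0 < τ := hτ0
  set q : Fin 4 → X := fun j ↦ φ.symm (f (τ * I ^ (j : ℕ))) with hq
  have hpq : ∀ j, edist p (q j) ≤ ENNReal.ofReal (2 * g * τ) := hτ1
  have hoqf : ∀ j, edist o (q j) ≠ ⊤ := fun j ↦ by
    refine ne_top_of_le_ne_top ?_ (edist_triangle o p (q j))
    rw [hop]
    exact ENNReal.add_ne_top.2 ⟨ENNReal.ofReal_ne_top, ne_top_of_le_ne_top ENNReal.ofReal_ne_top (hpq j)⟩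
  set s : Fin 4 → ℝ := fun j ↦ (edist o (q j)).toReal with hs
  have hoq : ∀ j, edist o (q j) = ENNReal.ofReal (s j) := fun j ↦ (ENNReal.ofReal_toReal (hoqf j)).symm
  have hs0 : ∀ j, 0 ≤ s j := fun j ↦ ENNReal.toReal_nonneg
  have hgτ : 0 ≤ 2 * g * τ := by positivity
  have hsle : ∀ j, s j ≤ r + 2 * g * τ := by
    intro j
    have := (edist_triangle o p (q j)).trans (add_le_add hop.le (hpq j))
    rw [hoq, ← ENNReal.ofReal_add hr hgτ] at this
    exact (ENNReal.ofReal_le_ofReal_iff (by positivity)).1 this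
  have hsge : ∀ j, r ≤ s j + 2 * g * τ := by
    intro j
    have := (edist_triangle o (q j) p).trans (add_le_add (hoq j).le ((edist_comm _ _).le.trans (hpq j)))
    rw [hop, ← ENNReal.ofReal_add (hs0 j) hgτ] at this
    exact (ENNReal.ofReal_le_ofReal_iff (by linarith [hs0 j])).1 this
  set D : Fin 4 → ℝ := fun j ↦ s j - r with hD
  have hDabs : ∀ j, |D j| ≤ 2 * g * τ := fun j ↦ abs_le.2
    ⟨by have := hsge j; simp only [hD]; linarith, by have := hsle j; simp only [hD]; linarith⟩
  have hDsq : ∀ j, D j ^ 2 ≤ 4 * g ^ 2 * τ ^ 2 := by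
    intro j
    have := pow_le_pow_left₀ (abs_nonneg _) (hDabs j) 2
    rw [sq_abs] at this
    linarith
  -- This is the comparison for `r Δ r`: `8 (2 + r)` from `mul_exp_add_one_le` plus `1` from the
  -- error, with `r < R`.
  have hrD : r * ∑ j, D j ≤ 4 * τ ^ 2 * g ^ 2 * (17 + 8 * R) := by
    rcases hg with h0 | ⟨h0, hgr⟩
    · rw [h0, zero_mul]; positivity
    · have h1 := hτ2.resolve_left h0.ne'
      have h2 : ∑ j, s j ≤ 4 * r + 4 * τ ^ 2 * (8 * (Real.exp (2 * r) - 1) + g ^ 2 / (r + 1)) := by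
        have e : ∑ j : Fin 4, edist o (φ.symm (f (τ * I ^ (j : ℕ)))) = ENNReal.ofReal (∑ j, s j) := by
          rw [ENNReal.ofReal_sum_of_nonneg fun j _ ↦ hs0 j]
          exact Finset.sum_congr rfl fun j _ ↦ hoq j
        rw [e] at h1
        refine (ENNReal.ofReal_le_ofReal_iff ?_).1 h1
        have := Real.add_one_le_exp (2 * r)
        have : 0 ≤ Real.exp (2 * r) - 1 := by linarith
        positivity
      have h3 : ∑ j, D j = ∑ j, s j - 4 * r := by
        simp [hD, Finset.sum_sub_distrib]
      have h4 : Real.exp (2 * r) - 1 = (Real.exp r + 1) * g := by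
        rw [hgr, two_mul, Real.exp_add]; ring
      have h5 : r * (Real.exp r + 1) ≤ (2 + r) * g := by rw [hgr]; exact mul_exp_add_one_le
      have h6 : r * (g ^ 2 / (r + 1)) ≤ g ^ 2 := by
        rw [mul_div_assoc', div_le_iff₀ (by linarith)]
        nlinarith [sq_nonneg g]
      have h7 : r * (8 * (Real.exp (2 * r) - 1) + g ^ 2 / (r + 1)) ≤ g ^ 2 * (17 + 8 * R) := by
        rw [h4]
        have := mul_le_mul_of_nonneg_right h5 hg0.le
        nlinarith [mul_nonneg (sq_nonneg g) (sub_nonneg.2 hrR.le)]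
      calc r * ∑ j, D j ≤ r * (4 * τ ^ 2 * (8 * (Real.exp (2 * r) - 1) + g ^ 2 / (r + 1))) := by
            rw [h3]; exact mul_le_mul_of_nonneg_left (by linarith) hr
        _ = 4 * τ ^ 2 * (r * (8 * (Real.exp (2 * r) - 1) + g ^ 2 / (r + 1))) := by ring
        _ ≤ 4 * τ ^ 2 * (g ^ 2 * (17 + 8 * R)) := by gcongr
        _ = _ := by ring
  -- `x j` is the relative decrease of the cut-off: `1 - s j² / R² = ρ (1 - x j)`. Maximality at `p`
  -- thus bounds `w (q j) - w p` by `-2 log (1 - x j)`.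
  set x : Fin 4 → ℝ := fun j ↦ (2 * r * D j + D j ^ 2) / (R ^ 2 * ρ) with hx
  have hB : 0 < R ^ 2 * ρ := by positivity
  have hxabs : ∀ j, |x j| ≤ 8 * R * g * τ / (R ^ 2 * ρ) := by
    intro j
    rw [hx, abs_div, abs_of_pos hB]
    refine div_le_div_of_nonneg_right ?_ hB.le
    refine (abs_add_le _ _).trans ?_
    rw [abs_mul, abs_of_nonneg (by positivity : 0 ≤ 2 * r), abs_of_nonneg (sq_nonneg (D j))]
    have h1 := mul_le_mul_of_nonneg_left (hDabs j) (by positivity : 0 ≤ 2 * r)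
    have h2 := hDsq j
    have h3 : g * τ * r ≤ g * τ * R := by gcongr
    have h4 : g * τ * (g * τ) ≤ g * τ * R := by gcongr
    nlinarith
  have hxhalf : ∀ j, |x j| ≤ 1 / 2 := fun j ↦ (hxabs j).trans (by
    rw [div_le_iff₀ hB]; linarith)
  have hxsq : ∀ j, x j ^ 2 ≤ 64 * g ^ 2 * τ ^ 2 / (R ^ 2 * ρ ^ 2) := by
    intro j
    have := pow_le_pow_left₀ (abs_nonneg _) (hxabs j) 2
    rw [sq_abs] at this
    refine this.trans (le_of_eq ?_)
    field_simp
    ring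
  have hwq : ∀ j, w (q j) ≤ w p + 2 * x j + 4 * x j ^ 2 := by
    intro j
    have h1 := hmax (q j) (s j) (hs0 j) (by linarith [hsle j]) (hoq j)
    have e : 1 - s j ^ 2 / R ^ 2 = ρ * (1 - x j) := by
      have : s j = r + D j := by simp [hD]
      have hRne : R ^ 2 ≠ 0 := by positivity
      have e1 : ρ * x j = (2 * r * D j + D j ^ 2) / R ^ 2 := by
        simp only [hx]; field_simp
      rw [mul_sub, e1, mul_one, this, hρ]
      field_simp
      ring
    have hpos : 0 < 1 - x j := by linarith [(abs_le.1 (hxhalf j)).2]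
    rw [e, Real.log_mul hρ0.ne' hpos.ne'] at h1
    linarith [neg_log_one_sub_le (hxhalf j)]
  have hsumx : ∑ j, x j ≤ g ^ 2 * τ ^ 2 * (8 * (17 + 8 * R) + 16) / (R ^ 2 * ρ) := by
    have e : ∑ j, x j = (2 * (r * ∑ j, D j) + ∑ j, D j ^ 2) / (R ^ 2 * ρ) := by
      simp only [hx]
      rw [← Finset.sum_div, Finset.sum_add_distrib, ← Finset.mul_sum]
      ring
    have h2 : ∑ j, D j ^ 2 ≤ 4 * (4 * g ^ 2 * τ ^ 2) := by
      refine (Finset.sum_le_sum fun j _ ↦ hDsq j).trans (le_of_eq ?_)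
      simp
    rw [e]
    exact div_le_div_of_nonneg_right (by linarith) hB.le
  have hsumx2 : ∑ j, x j ^ 2 ≤ 4 * (64 * g ^ 2 * τ ^ 2 / (R ^ 2 * ρ ^ 2)) := by
    refine (Finset.sum_le_sum fun j _ ↦ hxsq j).trans (le_of_eq ?_)
    simp
  have hsumw : ∑ j, w (q j) ≤ 4 * w p + 2 * ∑ j, x j + 4 * ∑ j, x j ^ 2 := by
    refine (Finset.sum_le_sum fun j _ ↦ hwq j).trans (le_of_eq ?_)
    rw [Finset.sum_add_distrib, Finset.sum_add_distrib, ← Finset.mul_sum, ← Finset.mul_sum]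
    simp
  have hlow : g ^ 2 * (2 * Real.exp (w p) - 2)
      ≤ ‖v‖ ^ 2 * Δ (fun z ↦ w (φ.symm z)) (φ p) := by
    have h1 := hwΔ φ hφ _ hz
    rw [φ.left_inv hp] at h1
    have h2 : Real.exp (-(L φ (φ p)) / 2) ^ 2 * Real.exp (L φ (φ p)) = 1 := by
      rw [← Real.exp_nat_mul, ← Real.exp_add]; simp; ring
    calc g ^ 2 * (2 * Real.exp (w p) - 2)
        = ‖v‖ ^ 2 * (Real.exp (L φ (φ p)) * (2 * Real.exp (w p) - 2)) := by
          rw [hvn]; linear_combination -(g ^ 2 * (2 * Real.exp (w p) - 2)) * h2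
      _ ≤ _ := mul_le_mul_of_nonneg_left h1 (sq_nonneg _)
  have hlow2 : 4 * w p + τ ^ 2 * (‖v‖ ^ 2 * Δ (fun z ↦ w (φ.symm z)) (φ p) - g ^ 2 / R ^ 2)
      ≤ ∑ j, w (q j) := by
    have := hτ3
    rw [hf0, hf1, φ.left_inv hp] at this
    exact this
  have hpos : 0 < τ ^ 2 * g ^ 2 := by positivity
  have hfin : τ ^ 2 * g ^ 2 * (2 * Real.exp (w p) - 2) ≤ τ ^ 2 * g ^ 2 *
      (1 / R ^ 2 + (304 + 128 * R) / (R ^ 2 * ρ) + 1024 / (R ^ 2 * ρ ^ 2)) := by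
    have h1 := mul_le_mul_of_nonneg_left hlow (sq_nonneg τ)
    have e1 : 2 * (g ^ 2 * τ ^ 2 * (8 * (17 + 8 * R) + 16) / (R ^ 2 * ρ))
        = τ ^ 2 * g ^ 2 * ((304 + 128 * R) / (R ^ 2 * ρ)) := by ring
    have e2 : 4 * (4 * (64 * g ^ 2 * τ ^ 2 / (R ^ 2 * ρ ^ 2)))
        = τ ^ 2 * g ^ 2 * (1024 / (R ^ 2 * ρ ^ 2)) := by ring
    have e3 : τ ^ 2 * (g ^ 2 / R ^ 2) = τ ^ 2 * g ^ 2 * (1 / R ^ 2) := by ring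
    nlinarith
  exact le_of_mul_le_mul_left hfin hpos

/-- A form of the Ahlfors–Schwarz–Yau lemma: on a complete surface of curvature at least `-1`, a
function with `Δ w ≥ 2 e^w - 2` is nonpositive. -/
theorem IsConformalAtlas.nonpos_of_laplacian_ge (h : IsConformalAtlas 𝒜 L)
    (hX : HasIntermediatePoints X)
    (hc : ∀ (o : X) (R : ℝ), IsCompact (Metric.closedEBall o (ENNReal.ofReal R)))
    {w : X → ℝ} (hwc : Continuous w)
    (hw : ∀ φ ∈ 𝒜, ∀ z ∈ φ.target, ContDiffAt ℝ 2 (fun z ↦ w (φ.symm z)) z)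
    (hwΔ : ∀ φ ∈ 𝒜, ∀ z ∈ φ.target, Real.exp (L φ z) * (2 * Real.exp (w (φ.symm z)) - 2)
      ≤ Δ (fun z ↦ w (φ.symm z)) z) (o : X) : w o ≤ 0 := by
  have key : ∀ R : ℝ, 1 ≤ R → 2 * Real.exp (w o) - 2 ≤ 1457 / R := by
    intro R hR1
    have hR : 0 < R := by linarith
    set K := Metric.closedEBall o (ENNReal.ofReal R)
    set T : X → ℝ := fun q ↦ (edist o q).toReal
    have hfin : ∀ q ∈ K, edist o q ≠ ⊤ := fun q hq ↦
      ne_top_of_le_ne_top ENNReal.ofReal_ne_top ((edist_comm _ _).le.trans hq)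
    have hTc : ContinuousOn T K := fun q hq ↦
      ((ENNReal.tendsto_toReal (hfin q hq)).comp
        (continuous_const.edist continuous_id).continuousAt.tendsto).mono_left nhdsWithin_le_nhds
    -- The exponentiated quantity is continuous up to the sphere of radius `R`, where it vanishes.
    -- As it is positive at `o`, its maximum lies at distance less than `R`.
    have hΦc : ContinuousOn (fun q ↦ Real.exp (w q) * (1 - T q ^ 2 / R ^ 2) ^ 2) K :=
      hwc.rexp.continuousOn.mul ((continuousOn_const.sub ((hTc.pow 2).div_const _)).pow 2)
    have hoK : o ∈ K := by simp [K]
    obtain ⟨p, hpK, hpmax⟩ := (hc o R).exists_isMaxOn ⟨o, hoK⟩ hΦc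
    have hTo : T o = 0 := by simp [T]
    have hΦo : Real.exp (w o) ≤ Real.exp (w p) * (1 - T p ^ 2 / R ^ 2) ^ 2 := by
      have := hpmax hoK
      simpa [hTo] using this
    have hr : 0 ≤ T p := ENNReal.toReal_nonneg
    have hrR' : T p ≤ R := by
      refine ENNReal.toReal_le_of_le_ofReal hR.le ?_
      rw [edist_comm]; exact hpK
    have hrR : T p < R := by
      refine hrR'.lt_of_ne fun h0 ↦ ?_
      rw [h0, div_self (by positivity)] at hΦo
      simp at hΦo
      linarith [Real.exp_pos (w o)]
    have hpos : ∀ s : ℝ, 0 ≤ s → s < R → 0 < 1 - s ^ 2 / R ^ 2 := by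
      intro s hs hsR
      rw [sub_pos, div_lt_one (by positivity)]
      exact pow_lt_pow_left₀ hsR hs (by norm_num)
    set ρ := 1 - T p ^ 2 / R ^ 2 with hρ
    have hρ0 : 0 < ρ := hpos _ hr hrR
    have hρ1 : ρ ≤ 1 := by
      have : 0 ≤ T p ^ 2 / R ^ 2 := by positivity
      linarith
    have hm := h.exp_le_of_isMax hX hc hw hwΔ hr hrR (ENNReal.ofReal_toReal (hfin p hpK)).symm hρ
      (by
        intro q s hs hsR hoq
        have hqK : q ∈ K := by
          rw [Metric.mem_closedEBall, edist_comm, hoq]; exact ENNReal.ofReal_le_ofReal hsR.le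
        have hTq : T q = s := by simp only [T, hoq, ENNReal.toReal_ofReal hs]
        have h1 := hpmax hqK
        simp only [mem_ofPred_eq, hTq] at h1
        have hps := hpos s hs hsR
        have h2 := Real.log_le_log (by positivity) h1
        rw [Real.log_mul (Real.exp_ne_zero _) (by positivity), Real.log_exp, Real.log_pow,
          Real.log_mul (Real.exp_ne_zero _) (by positivity), Real.log_exp, Real.log_pow] at h2
        exact_mod_cast h2)
    -- Maximality gives `e^{w(o)} ≤ e^{w(p)} ρ²`, so multiplying by `ρ² ≤ 1` passes from `p` to `o`
    -- and also clears the denominators. For `R ≥ 1` the constants add up to `1 + 304 + 128 + 1024 =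
    -- 1457`.
    have hm2 := mul_le_mul_of_nonneg_right hm (sq_nonneg ρ)
    have e1 : (1 / R ^ 2 + (304 + 128 * R) / (R ^ 2 * ρ) + 1024 / (R ^ 2 * ρ ^ 2)) * ρ ^ 2
        = (ρ ^ 2 + (304 + 128 * R) * ρ + 1024) / R ^ 2 := by
      field_simp
    have hρ2 : ρ ^ 2 ≤ 1 := pow_le_one₀ hρ0.le hρ1
    have h3 : (ρ ^ 2 + (304 + 128 * R) * ρ + 1024) / R ^ 2 ≤ 1457 / R := by
      rw [div_le_div_iff₀ (by positivity) hR]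
      have : ρ ^ 2 + (304 + 128 * R) * ρ + 1024 ≤ 1457 * R := by nlinarith
      nlinarith [mul_le_mul_of_nonneg_right this hR.le]
    rw [e1] at hm2
    nlinarith
  by_contra hcon
  have hpos : 0 < 2 * Real.exp (w o) - 2 := by
    have := Real.one_lt_exp_iff.2 (not_le.1 hcon)
    linarith
  have h1 := key (max 1 (1458 / (2 * Real.exp (w o) - 2))) (le_max_left _ _)
  have hM : 0 < max 1 (1458 / (2 * Real.exp (w o) - 2)) := lt_max_of_lt_left one_pos
  rw [le_div_iff₀ hM] at h1
  have h2 := mul_le_mul_of_nonneg_left (le_max_right 1 (1458 / (2 * Real.exp (w o) - 2))) hpos.le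
  rw [mul_div_cancel₀ _ hpos.ne'] at h2
  linarith

end WangSurface

end

/-! ### Holomorphic charts and the transformation of conformal densities. -/

noncomputable section

namespace WangSurface

open Set Manifold

variable {S : Type*} [TopologicalSpace S] [ChartedSpace ℂ S]

theorem IsHolChart.mem_real_maximalAtlas {φ : OpenPartialHomeomorph S ℂ} (hφ : IsHolChart φ)
    (n : ℕ∞ω) : φ ∈ IsManifold.maximalAtlas 𝓘(ℝ, ℂ) n S := by
  have key : ∀ e : OpenPartialHomeomorph ℂ ℂ, e ∈ contDiffGroupoid ω 𝓘(ℂ) →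
      e ∈ contDiffGroupoid n 𝓘(ℝ, ℂ) := by
    intro e he
    rw [contDiffGroupoid, mem_groupoid_of_pregroupoid] at he ⊢
    exact ⟨(ContDiffOn.restrict_scalars ℝ he.1).of_le le_top,
      (ContDiffOn.restrict_scalars ℝ he.2).of_le le_top⟩
  rw [IsManifold.mem_maximalAtlas_iff]
  intro e he
  have := IsManifold.mem_maximalAtlas_iff.1 hφ e he
  exact ⟨key _ this.1, key _ this.2⟩

theorem IsHolChart.contDiffOn_transition {φ ψ : OpenPartialHomeomorph S ℂ} (hφ : IsHolChart φ)
    (hψ : IsHolChart ψ) : ContDiffOn ℂ ω (fun z ↦ ψ (φ.symm z)) (φ.symm ≫ₕ ψ).source := by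
  have h := StructureGroupoid.compatible_of_mem_maximalAtlas hφ hψ
  rw [contDiffGroupoid, mem_groupoid_of_pregroupoid] at h
  have := h.1
  simpa [contDiffPregroupoid, Function.comp_def] using this

theorem IsHolChart.analyticAt_transition {φ ψ : OpenPartialHomeomorph S ℂ} (hφ : IsHolChart φ)
    (hψ : IsHolChart ψ) {z : ℂ} (hz : z ∈ φ.target) (hz' : φ.symm z ∈ ψ.source) :
    AnalyticAt ℂ (fun z ↦ ψ (φ.symm z)) z := by
  refine ((hφ.contDiffOn_transition hψ).contDiffAt ?_).analyticAt
  exact (φ.symm ≫ₕ ψ).open_source.mem_nhds ⟨hz, hz'⟩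

theorem IsHolChart.mdifferentiableAt_symm {φ : OpenPartialHomeomorph S ℂ} (hφ : IsHolChart φ)
    {z : ℂ} (hz : z ∈ φ.target) : MDifferentiableAt 𝓘(ℝ, ℂ) 𝓘(ℝ, ℂ) φ.symm z :=
  (((contMDiffOn_symm_of_mem_maximalAtlas (hφ.mem_real_maximalAtlas 1)) z hz).contMDiffAt
    (φ.open_target.mem_nhds hz)).mdifferentiableAt one_ne_zero

theorem IsHolChart.mdifferentiableAt {φ : OpenPartialHomeomorph S ℂ} (hφ : IsHolChart φ)
    {p : S} (hp : p ∈ φ.source) : MDifferentiableAt 𝓘(ℝ, ℂ) 𝓘(ℝ, ℂ) φ p :=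
  (((contMDiffOn_of_mem_maximalAtlas (hφ.mem_real_maximalAtlas 1)) p hp).contMDiffAt
    (φ.open_source.mem_nhds hp)).mdifferentiableAt one_ne_zero

theorem IsHolChart.realVec_ne_zero {φ : OpenPartialHomeomorph S ℂ} (hφ : IsHolChart φ)
    {z : ℂ} (hz : z ∈ φ.target) : realVec φ z 1 ≠ 0 := by
  intro h0
  have h1 := (hφ.mdifferentiableAt (φ.map_target hz)).hasMFDerivAt.comp z
    (hφ.mdifferentiableAt_symm hz).hasMFDerivAt
  have h2 : HasMFDerivAt 𝓘(ℝ, ℂ) 𝓘(ℝ, ℂ) (φ ∘ φ.symm) z (ContinuousLinearMap.id ℝ ℂ) := by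
    refine (hasMFDerivAt_id z).congr_of_eventuallyEq ?_
    filter_upwards [φ.open_target.mem_nhds hz] with y hy using φ.right_inv hy
  have h3 := congrArg (fun l : ℂ →L[ℝ] ℂ ↦ l 1) (hasMFDerivAt_unique h1 h2)
  have h4 : mfderiv 𝓘(ℝ, ℂ) 𝓘(ℝ, ℂ) φ (φ.symm z) (realVec φ z 1) = (1 : ℂ) := h3
  rw [h0, map_zero] at h4
  exact zero_ne_one (α := ℂ) h4

theorem IsHolChart.density_pos {φ : OpenPartialHomeomorph S ℂ} (hφ : IsHolChart φ) (g : Metric S)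
    {z : ℂ} (hz : z ∈ φ.target) : 0 < density g φ z :=
  g.pos _ _ (hφ.realVec_ne_zero hz)

theorem IsHolChart.realVec_transition {φ ψ : OpenPartialHomeomorph S ℂ} (hφ : IsHolChart φ)
    (hψ : IsHolChart ψ) {z : ℂ} (hz : z ∈ φ.target) (hz' : φ.symm z ∈ ψ.source) (ξ : ℂ) :
    (realVec φ z ξ : ℂ) = (realVec ψ (ψ (φ.symm z)) (deriv (fun z ↦ ψ (φ.symm z)) z * ξ) : ℂ) := by
  set T : ℂ → ℂ := fun z ↦ ψ (φ.symm z) with hT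
  have hTd : HasFDerivAt T ((ContinuousLinearMap.toSpanSingleton ℂ (deriv T z)).restrictScalars ℝ) z :=
    (hφ.analyticAt_transition hψ hz hz').differentiableAt.hasDerivAt.hasFDerivAt.restrictScalars ℝ
  have h1 := (hψ.mdifferentiableAt_symm (ψ.map_source hz')).hasMFDerivAt.comp z
    hTd.hasMFDerivAt
  have h2 : HasMFDerivAt 𝓘(ℝ, ℂ) 𝓘(ℝ, ℂ) (ψ.symm ∘ T) z
      (mfderiv 𝓘(ℝ, ℂ) 𝓘(ℝ, ℂ) φ.symm z : ℂ →L[ℝ] ℂ) := by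
    refine HasMFDerivAt.congr_of_eventuallyEq
      (hφ.mdifferentiableAt_symm hz).hasMFDerivAt ?_
    filter_upwards [(φ.symm ≫ₕ ψ).open_source.mem_nhds ⟨hz, hz'⟩] with y hy
    exact ψ.left_inv hy.2
  have h3 := congrArg (fun l : ℂ →L[ℝ] ℂ ↦ l ξ) (hasMFDerivAt_unique h2 h1)
  refine h3.trans ?_
  simp only [realVec]
  change (mfderiv 𝓘(ℝ, ℂ) 𝓘(ℝ, ℂ) ψ.symm (T z) : ℂ →L[ℝ] ℂ) _ = (mfderiv 𝓘(ℝ, ℂ) 𝓘(ℝ, ℂ) ψ.symm (T z) : ℂ →L[ℝ] ℂ) _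
  congr 1
  change ξ • deriv T z = deriv T z * ξ
  rw [smul_eq_mul, mul_comm]

theorem IsConformal.density_transition {g : Metric S} (hg : IsConformal g)
    {φ ψ : OpenPartialHomeomorph S ℂ} (hφ : IsHolChart φ)
    (hψ : IsHolChart ψ) {z : ℂ} (hz : z ∈ φ.target) (hz' : φ.symm z ∈ ψ.source) :
    density g φ z
      = density g ψ (ψ (φ.symm z)) * ‖deriv (fun z ↦ ψ (φ.symm z)) z‖ ^ 2 := by
  -- The base points `φ.symm z` and `ψ.symm (ψ (φ.symm z))` are equal only propositionally.
  -- Regarding every tangent space as `ℂ` allows the substitution.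
  have key : ∀ (p q : S) (v : ℂ), p = q → (g.inner p : ℂ →L[ℝ] ℂ →L[ℝ] ℝ) v v
      = (g.inner q : ℂ →L[ℝ] ℂ →L[ℝ] ℝ) v v := by
    rintro p q v rfl; rfl
  have h1 := hφ.realVec_transition hψ hz hz' 1
  have h2 := hg ψ hψ _ (ψ.map_source hz') (deriv (fun z ↦ ψ (φ.symm z)) z * 1)
    (deriv (fun z ↦ ψ (φ.symm z)) z * 1)
  rw [real_inner_self_eq_norm_sq, mul_one] at h2
  rw [mul_one] at h1
  rw [← h2]
  have h3 := key (φ.symm z) (ψ.symm (ψ (φ.symm z))) (realVec φ z 1) (ψ.left_inv hz').symm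
  refine Eq.trans h3 ?_
  rw [h1]

end WangSurface

end

/-! ### The Riemannian distance in conformal charts. -/

noncomputable section

namespace WangSurface

open Set Manifold

variable {S : Type*} [TopologicalSpace S] [ChartedSpace ℂ S]
  [Bundle.RiemannianBundle (fun p : S ↦ TangentSpace 𝓘(ℝ, ℂ) p)]

theorem IsHolChart.pathELength_eq {L : ℂ → ℝ} {φ : OpenPartialHomeomorph S ℂ} (hφ : IsHolChart φ)
    (hconf : ∀ z ∈ φ.target, ∀ ξ : ℂ, ‖realVec φ z ξ‖ = Real.exp (L z / 2) * ‖ξ‖)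
    (hL : ∀ z ∈ φ.target, ContinuousAt L z) {c c' : ℝ → ℂ} (hc : IsC1Curve c c')
    (ht : ∀ t ∈ Icc (0 : ℝ) 1, c t ∈ φ.target) :
    pathELength 𝓘(ℝ, ℂ) (fun t ↦ φ.symm (c t)) 0 1 = ENNReal.ofReal (confLength L c c') := by
  -- Only interior times are used: at the endpoints the derivative of `c` is one-sided, and they
  -- have measure zero.
  have hspeed : ∀ t ∈ Ioo (0 : ℝ) 1, ‖mfderiv 𝓘(ℝ, ℝ) 𝓘(ℝ, ℂ) (fun t ↦ φ.symm (c t)) t 1‖ₑ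
      = ENNReal.ofReal (confSpeed L c c' t) := by
    intro t hto
    have hti := Ioo_subset_Icc_self hto
    have hd : HasDerivAt c (c' t) t := (hc.hasDeriv t hti).hasDerivAt (Icc_mem_nhds hto.1 hto.2)
    have h1 := (hφ.mdifferentiableAt_symm (ht t hti)).hasMFDerivAt.comp t
      hd.hasFDerivAt.hasMFDerivAt
    have h2 : mfderiv 𝓘(ℝ, ℝ) 𝓘(ℝ, ℂ) (fun t ↦ φ.symm (c t)) t 1 = realVec φ (c t) (c' t) := by
      have e : mfderiv 𝓘(ℝ, ℝ) 𝓘(ℝ, ℂ) (fun t ↦ φ.symm (c t)) t = _ := h1.mfderiv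
      rw [e]
      change (mfderiv 𝓘(ℝ, ℂ) 𝓘(ℝ, ℂ) φ.symm (c t) : ℂ →L[ℝ] ℂ) ((1 : ℝ) • c' t) = _
      rw [one_smul]
      rfl
    rw [h2, ← ofReal_norm, hconf _ (ht t hti)]
    rfl
  rw [pathELength_eq_lintegral_mfderiv_Ioo,
    MeasureTheory.setLIntegral_congr_fun measurableSet_Ioo hspeed, confLength,
    intervalIntegral.integral_of_le zero_le_one, MeasureTheory.integral_Ioc_eq_integral_Ioo,
    MeasureTheory.ofReal_integral_eq_lintegral_ofReal]
  · have := (hc.intervalIntegrable_confSpeed fun t h ↦ hL _ (ht t h)).1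
    exact this.mono_set Ioo_subset_Ioc_self
  · exact Eventually.of_forall fun t ↦ confSpeed_nonneg _ _ _ _

theorem IsHolChart.riemannianEDist_le {L : ℂ → ℝ} {φ : OpenPartialHomeomorph S ℂ}
    (hφ : IsHolChart φ)
    (hconf : ∀ z ∈ φ.target, ∀ ξ : ℂ, ‖realVec φ z ξ‖ = Real.exp (L z / 2) * ‖ξ‖)
    (hL : ∀ z ∈ φ.target, ContinuousAt L z) {c c' : ℝ → ℂ} (hc : IsC1Curve c c')
    (ht : ∀ t ∈ Icc (0 : ℝ) 1, c t ∈ φ.target) :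
    riemannianEDist 𝓘(ℝ, ℂ) (φ.symm (c 0)) (φ.symm (c 1))
      ≤ ENNReal.ofReal (confLength L c c') := by
  rw [← hφ.pathELength_eq hconf hL hc ht]
  refine riemannianEDist_le_pathELength (γ := fun t ↦ φ.symm (c t)) ?_ rfl rfl zero_le_one
  have h1 : ContDiffOn ℝ 1 c (Icc 0 1) := by
    have hu := uniqueDiffOn_Icc (zero_lt_one (α := ℝ))
    rw [contDiffOn_one_iff_derivWithin hu]
    refine ⟨fun t h ↦ (hc.hasDeriv t h).differentiableWithinAt, hc.continuousOn.congr fun t h ↦ ?_⟩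
    exact (hc.hasDeriv t h).derivWithin (hu t h)
  exact (contMDiffOn_symm_of_mem_maximalAtlas (hφ.mem_real_maximalAtlas 1)).comp
    h1.contMDiffOn ht

theorem riemannianEDist_le_of_path {γ : ℝ → S} (hγ : ContMDiff 𝓘(ℝ, ℝ) 𝓘(ℝ, ℂ) 1 γ) {a b : ℝ}
    (hab : a ≤ b) : riemannianEDist 𝓘(ℝ, ℂ) (γ a) (γ b) ≤ pathELength 𝓘(ℝ, ℂ) γ a b :=
  riemannianEDist_le_pathELength hγ.contMDiffOn rfl rfl hab

theorem IsHolChart.exists_curve {L : ℂ → ℝ} {φ : OpenPartialHomeomorph S ℂ}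
    (hφ : IsHolChart φ)
    (hconf : ∀ z ∈ φ.target, ∀ ξ : ℂ, ‖realVec φ z ξ‖ = Real.exp (L z / 2) * ‖ξ‖)
    (hL : ∀ z ∈ φ.target, ContinuousAt L z) {x y : S} {D : ℝ}
    (hD : riemannianEDist 𝓘(ℝ, ℂ) x y < ENNReal.ofReal D)
    (hs : ∀ q, riemannianEDist 𝓘(ℝ, ℂ) x q < ENNReal.ofReal D → q ∈ φ.source) :
    ∃ c c' : ℝ → ℂ, IsC1Curve c c' ∧ c 0 = φ x ∧ c 1 = φ y ∧
      (∀ t ∈ Icc (0 : ℝ) 1, c t ∈ φ.target ∧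
        riemannianEDist 𝓘(ℝ, ℂ) x (φ.symm (c t)) < ENNReal.ofReal D) ∧
      confLength L c c' < D := by
  obtain ⟨γ, h0, h1, hγ, hlen, -, -⟩ :=
    exists_lt_locally_constant_of_riemannianEDist_lt hD zero_lt_one
  -- Every initial piece of a path of length less than `D` is shorter than `D`, so the path never
  -- leaves the ball, and hence not the chart domain.
  have hdist : ∀ t ∈ Icc (0 : ℝ) 1, riemannianEDist 𝓘(ℝ, ℂ) x (γ t) < ENNReal.ofReal D := by
    intro t ht
    have := riemannianEDist_le_of_path hγ ht.1
    rw [h0] at this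
    exact (this.trans (pathELength_mono le_rfl ht.2)).trans_lt hlen
  have hsrc : ∀ t ∈ Icc (0 : ℝ) 1, γ t ∈ φ.source := fun t ht ↦ hs _ (hdist t ht)
  have hcd : ∀ t ∈ Icc (0 : ℝ) 1, ContDiffAt ℝ 1 (fun t ↦ φ (γ t)) t := by
    intro t ht
    have h2 : ContMDiffAt 𝓘(ℝ, ℂ) 𝓘(ℝ, ℂ) 1 φ (γ t) :=
      ((contMDiffOn_of_mem_maximalAtlas (hφ.mem_real_maximalAtlas 1)) _ (hsrc t ht)).contMDiffAt
        (φ.open_source.mem_nhds (hsrc t ht))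
    exact (h2.comp t hγ.contMDiffAt).contDiffAt
  have hcurve : IsC1Curve (fun t ↦ φ (γ t)) (deriv fun t ↦ φ (γ t)) := by
    refine ⟨fun t ht ↦ ((hcd t ht).differentiableAt one_ne_zero).hasDerivAt.hasDerivWithinAt,
      fun t ht ↦ ?_⟩
    have h3 : ContinuousAt (fun s ↦ fderiv ℝ (fun t ↦ φ (γ t)) s 1) t :=
      (((hcd t ht).fderiv_right (m := 0) (by norm_num)).continuousAt).clm_apply continuousAt_const
    exact h3.continuousWithinAt
  have htgt : ∀ t ∈ Icc (0 : ℝ) 1, φ (γ t) ∈ φ.target := fun t ht ↦ φ.map_source (hsrc t ht)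
  refine ⟨_, _, hcurve, by simp [h0], by simp [h1], fun t ht ↦ ⟨htgt t ht, ?_⟩, ?_⟩
  · rw [φ.left_inv (hsrc t ht)]
    exact hdist t ht
  · have h4 : pathELength 𝓘(ℝ, ℂ) (fun t ↦ φ.symm (φ (γ t))) 0 1 = pathELength 𝓘(ℝ, ℂ) γ 0 1 :=
      pathELength_congr fun t ht ↦ φ.left_inv (hsrc t ht)
    rw [← h4, hφ.pathELength_eq hconf hL hcurve htgt] at hlen
    exact (ENNReal.ofReal_lt_ofReal_iff'.1 hlen).1

/-- The Riemannian distance is a length distance. -/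
theorem exists_intermediate_riemannianEDist
    (hcont : ∀ x : S, Continuous fun y ↦ riemannianEDist 𝓘(ℝ, ℂ) x y) (x y : S) (a b : ℝ)
    (ha : 0 < a) (hb : 0 < b) (h : riemannianEDist 𝓘(ℝ, ℂ) x y < ENNReal.ofReal (a + b)) :
    ∃ z, riemannianEDist 𝓘(ℝ, ℂ) x z < ENNReal.ofReal a ∧
      riemannianEDist 𝓘(ℝ, ℂ) z y < ENNReal.ofReal b := by
  rcases lt_or_ge (riemannianEDist 𝓘(ℝ, ℂ) x y) (ENNReal.ofReal a) with hlt | hge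
  · exact ⟨y, hlt, by rw [riemannianEDist_self]; exact ENNReal.ofReal_pos.2 hb⟩
  obtain ⟨γ, h0, h1, hγ, hlen, -, -⟩ :=
    exists_lt_locally_constant_of_riemannianEDist_lt h zero_lt_one
  set ℓ := (pathELength 𝓘(ℝ, ℂ) γ 0 1).toReal
  have hℓ : pathELength 𝓘(ℝ, ℂ) γ 0 1 = ENNReal.ofReal ℓ :=
    (ENNReal.ofReal_toReal (hlen.trans ENNReal.ofReal_lt_top).ne).symm
  have hℓab : ℓ < a + b := by
    rw [hℓ] at hlen; exact (ENNReal.ofReal_lt_ofReal_iff'.1 hlen).1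
  -- The path passes through a point at distance exactly `m` from `x`. Since `m > ℓ - b`, the rest
  -- of the path is shorter than `b`.
  obtain ⟨m, hm1, hm2⟩ := exists_between (show max 0 (ℓ - b) < a from max_lt ha (by linarith))
  have hm0 : 0 < m := (le_max_left _ _).trans_lt hm1
  have hmℓ : ℓ - b < m := (le_max_right _ _).trans_lt hm1
  have hivt := intermediate_value_Icc (zero_le_one (α := ℝ))
    (((hcont x).comp hγ.continuous).continuousOn)
  obtain ⟨t, ht, htm⟩ : ENNReal.ofReal m ∈ _ := hivt ⟨by
    simp [h0, riemannianEDist_self], by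
    simp only [Function.comp_apply, h1]
    exact (ENNReal.ofReal_le_ofReal hm2.le).trans hge⟩
  simp only [Function.comp_apply] at htm
  refine ⟨γ t, by rw [htm]; exact (ENNReal.ofReal_lt_ofReal_iff ha).2 hm2, ?_⟩
  have h2 := riemannianEDist_le_of_path hγ ht.1
  have h3 := riemannianEDist_le_of_path hγ ht.2
  have h4 := pathELength_add (I := 𝓘(ℝ, ℂ)) (γ := γ) ht.1 ht.2
  rw [h0, htm] at h2
  rw [h1] at h3
  have h5 : ENNReal.ofReal m + riemannianEDist 𝓘(ℝ, ℂ) (γ t) y ≤ ENNReal.ofReal ℓ := by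
    rw [← hℓ, ← h4]; exact add_le_add h2 h3
  have h6 : ENNReal.ofReal m + riemannianEDist 𝓘(ℝ, ℂ) (γ t) y
      < ENNReal.ofReal m + ENNReal.ofReal b := by
    rw [← ENNReal.ofReal_add hm0.le hb.le]
    exact h5.trans_lt ((ENNReal.ofReal_lt_ofReal_iff (by linarith)).2 (by linarith))
  exact (ENNReal.add_lt_add_iff_left ENNReal.ofReal_ne_top).1 h6

end WangSurface

end

/-! ### Regularity of the metrics `k` and `h`. -/

noncomputable section

namespace WangSurface

open Set Manifold

variable {S : Type*} [TopologicalSpace S] [ChartedSpace ℂ S] [IsManifold 𝓘(ℂ) ω S]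

theorem IsHolChart.contMDiffOn_realVec {φ : OpenPartialHomeomorph S ℂ} (hφ : IsHolChart φ)
    (n : ℕ∞) (ξ : ℂ) : ContMDiffOn 𝓘(ℝ, ℂ) 𝓘(ℝ, ℂ).tangent n
      (fun z ↦ (⟨φ.symm z, realVec φ z ξ⟩ : TangentBundle 𝓘(ℝ, ℂ) S)) φ.target := by
  have h1 := (contMDiffOn_symm_of_mem_maximalAtlas (hφ.mem_real_maximalAtlas (n + 1))
    ).contMDiffOn_tangentMapWithin (m := n) le_rfl φ.open_target.uniqueMDiffOn
  have h2 : ContMDiff 𝓘(ℝ, ℂ) 𝓘(ℝ, ℂ).tangent n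
      (fun z : ℂ ↦ (⟨z, ξ⟩ : TangentBundle 𝓘(ℝ, ℂ) ℂ)) := by
    intro z
    rw [contMDiffAt_vectorSpace_iff_contDiffAt (V := fun _ ↦ ξ)]
    exact contDiffAt_const
  refine (h1.comp h2.contMDiffOn (s := φ.target) fun z hz ↦ hz).congr fun z hz ↦ ?_
  change _ = tangentMapWithin 𝓘(ℝ, ℂ) 𝓘(ℝ, ℂ) φ.symm φ.target ⟨z, ξ⟩
  rw [tangentMapWithin, mfderivWithin_of_isOpen φ.open_target hz]
  rfl

theorem IsHolChart.contDiffAt_density {φ : OpenPartialHomeomorph S ℂ} (hφ : IsHolChart φ)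
    (k : SmoothMetric S) {z : ℂ} (hz : z ∈ φ.target) :
    ContDiffAt ℝ 2 (density k.toRiemannianMetric φ) z := by
  let : Bundle.RiemannianBundle (fun p : S ↦ TangentSpace 𝓘(ℝ, ℂ) p) := ⟨k.toRiemannianMetric⟩
  have h1 := ((hφ.contMDiffOn_realVec 2 1) z hz).contMDiffAt (φ.open_target.mem_nhds hz)
  have : IsContMDiffRiemannianBundle 𝓘(ℝ, ℂ) 2 ℂ (fun p : S ↦ TangentSpace 𝓘(ℝ, ℂ) p) :=
    ⟨k.inner, k.contMDiff.of_le (by norm_cast), fun _ _ _ ↦ rfl⟩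
  exact (ContMDiffAt.inner_bundle h1 h1).contDiffAt

theorem isContinuousRiemannianBundle_of_conformal (k : SmoothMetric S) {f : S → ℝ}
    (hf : Continuous f) (h : Metric S)
    (hh : ∀ (p : S) (v w : TangentSpace 𝓘(ℝ, ℂ) p), h.inner p v w = f p * k.inner p v w) :
    letI : Bundle.RiemannianBundle (fun p : S ↦ TangentSpace 𝓘(ℝ, ℂ) p) := ⟨h⟩
    IsContinuousRiemannianBundle ℂ (fun p : S ↦ TangentSpace 𝓘(ℝ, ℂ) p) := by
  let : Bundle.RiemannianBundle (fun p : S ↦ TangentSpace 𝓘(ℝ, ℂ) p) := ⟨h⟩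
  refine ⟨fun p ↦ f p • k.inner p, ?_, fun p v w ↦ hh p v w⟩
  have h0 : ContMDiff 𝓘(ℝ, ℂ) 𝓘(ℝ) 0 f := contMDiff_zero_iff.2 hf
  exact (h0.smul_section (k.contMDiff.of_le bot_le)).continuous

end WangSurface

end

/-! ### Wang's equation, the curvature of the Blaschke metric, and the conclusion. -/

noncomputable section

namespace WangSurface

open Set Manifold

section LogDensity

variable {S : Type*} [TopologicalSpace S] [ChartedSpace ℂ S] {φ : OpenPartialHomeomorph S ℂ}

/-- The logarithm of the density of a metric. -/
def logDensity (g : Metric S) (φ : OpenPartialHomeomorph S ℂ) (z : ℂ) : ℝ :=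
  Real.log (density g φ z)

theorem IsHolChart.exp_logDensity (hφ : IsHolChart φ) (g : Metric S) {z : ℂ}
    (hz : z ∈ φ.target) : Real.exp (logDensity g φ z) = density g φ z :=
  Real.exp_log (hφ.density_pos g hz)

theorem IsHolChart.exp_logDensity_half (hφ : IsHolChart φ) (g : Metric S) {z : ℂ}
    (hz : z ∈ φ.target) : Real.exp (logDensity g φ z / 2) = √(density g φ z) := by
  rw [← hφ.exp_logDensity g hz, Real.exp_half]

theorem IsHolChart.contDiffAt_comp_symm (hφ : IsHolChart φ) {u : S → ℝ}
    (hu : ContMDiff 𝓘(ℝ, ℂ) 𝓘(ℝ) 2 u) {z : ℂ} (hz : z ∈ φ.target) :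
    ContDiffAt ℝ 2 (fun z ↦ u (φ.symm z)) z :=
  (hu.contMDiffAt.comp z (((contMDiffOn_symm_of_mem_maximalAtlas
    (hφ.mem_real_maximalAtlas 2)) z hz).contMDiffAt (φ.open_target.mem_nhds hz))).contDiffAt

theorem IsConformal.exp_logDensity_transition {g : Metric S} (hg : IsConformal g)
    {φ ψ : OpenPartialHomeomorph S ℂ} (hφ : IsHolChart φ)
    (hψ : IsHolChart ψ) {z : ℂ} (hz : z ∈ φ.target) (hz' : φ.symm z ∈ ψ.source) :
    Real.exp (logDensity g φ z / 2) = Real.exp (logDensity g ψ (ψ (φ.symm z)) / 2)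
      * ‖deriv (fun z ↦ ψ (φ.symm z)) z‖ := by
  rw [hφ.exp_logDensity_half g hz, hψ.exp_logDensity_half g (ψ.map_source hz'),
    hg.density_transition hφ hψ hz hz', Real.sqrt_mul (hψ.density_pos g (ψ.map_source hz')).le,
    Real.sqrt_sq (norm_nonneg _)]

theorem IsConformal.norm_realVec {g : Metric S} (hg : IsConformal g)
    (hφ : IsHolChart φ) {z : ℂ} (hz : z ∈ φ.target) (ξ : ℂ) :
    let : Bundle.RiemannianBundle (fun p : S ↦ TangentSpace 𝓘(ℝ, ℂ) p) := ⟨g⟩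
    ‖realVec φ z ξ‖ = Real.exp (logDensity g φ z / 2) * ‖ξ‖ := by
  intro _
  have h1 : ‖realVec φ z ξ‖ ^ 2 = density g φ z * inner ℝ ξ ξ := by
    rw [← real_inner_self_eq_norm_sq]
    exact hg φ hφ z hz ξ ξ
  rw [hφ.exp_logDensity_half g hz, ← Real.sqrt_sq (norm_nonneg (realVec φ z ξ)), h1,
    real_inner_self_eq_norm_sq, Real.sqrt_mul (hφ.density_pos g hz).le,
    Real.sqrt_sq (norm_nonneg ξ)]

end LogDensity

section Rescale

variable {S : Type*} [TopologicalSpace S] [ChartedSpace ℂ S] [IsManifold 𝓘(ℂ) ω S]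
  {k : SmoothMetric S} {u : S → ℝ} {h : Metric S} {φ : OpenPartialHomeomorph S ℂ}

theorem density_rescale
    (hh : ∀ (p : S) (v w : TangentSpace 𝓘(ℝ, ℂ) p),
      h.inner p v w = Real.exp (u p) * k.inner p v w) (z : ℂ) :
    density h φ z = Real.exp (u (φ.symm z)) * density k.toRiemannianMetric φ z :=
  hh _ _ _

theorem isConformal_rescale (hk : IsConformal k.toRiemannianMetric)
    (hh : ∀ (p : S) (v w : TangentSpace 𝓘(ℝ, ℂ) p),
      h.inner p v w = Real.exp (u p) * k.inner p v w) : IsConformal h := by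
  intro φ hφ z hz ξ η
  rw [density_rescale hh, mul_assoc, ← hk φ hφ z hz ξ η]
  exact hh _ _ _

theorem logDensity_rescale_eventuallyEq (hφ : IsHolChart φ)
    (hh : ∀ (p : S) (v w : TangentSpace 𝓘(ℝ, ℂ) p),
      h.inner p v w = Real.exp (u p) * k.inner p v w) {z : ℂ} (hz : z ∈ φ.target) :
    logDensity h φ =ᶠ[𝓝 z] (fun z ↦ u (φ.symm z)) + logDensity k.toRiemannianMetric φ := by
  filter_upwards [φ.open_target.mem_nhds hz] with y hy
  rw [logDensity, density_rescale hh, Real.log_mul (Real.exp_ne_zero _)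
    (hφ.density_pos _ hy).ne', Real.log_exp]
  rfl

theorem IsHolChart.contDiffAt_logDensity (hφ : IsHolChart φ) (k : SmoothMetric S) {z : ℂ}
    (hz : z ∈ φ.target) : ContDiffAt ℝ 2 (logDensity k.toRiemannianMetric φ) z :=
  (hφ.contDiffAt_density k hz).log (hφ.density_pos _ hz).ne'

theorem contDiffAt_logDensity_rescale (hφ : IsHolChart φ) (hu : ContMDiff 𝓘(ℝ, ℂ) 𝓘(ℝ) 2 u)
    (hh : ∀ (p : S) (v w : TangentSpace 𝓘(ℝ, ℂ) p),
      h.inner p v w = Real.exp (u p) * k.inner p v w) {z : ℂ} (hz : z ∈ φ.target) :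
    ContDiffAt ℝ 2 (logDensity h φ) z :=
  ((hφ.contDiffAt_comp_symm hu hz).add (hφ.contDiffAt_logDensity k hz)).congr_of_eventuallyEq
    (logDensity_rescale_eventuallyEq hφ hh hz)

theorem IsConformalHyperbolic.laplacian_logDensity
    (hk : IsConformalHyperbolic k.toRiemannianMetric) (hφ : IsHolChart φ) {z : ℂ}
    (hz : z ∈ φ.target) : Δ (logDensity k.toRiemannianMetric φ) z
      = 2 * density k.toRiemannianMetric φ z := by
  have h1 := hk.2 φ hφ z hz
  have h2 := hφ.density_pos k.toRiemannianMetric hz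
  rw [gaussCurvature, div_eq_iff (by positivity)] at h1
  change Δ (fun w : ℂ ↦ Real.log (density k.toRiemannianMetric φ w)) z = _
  linarith

/-- The cubic term is nonnegative and may be dropped; curvature `-1` turns `-2 κ` into `+2`. -/
theorem SolvesWang.laplacian_le {U : CubicDifferential S}
    (hk : IsConformalHyperbolic k.toRiemannianMetric)
    (hu : SolvesWang k.toRiemannianMetric U u) (hφ : IsHolChart φ) {z : ℂ}
    (hz : z ∈ φ.target) : Δ (fun z ↦ u (φ.symm z)) z
      ≤ density k.toRiemannianMetric φ z * (2 * Real.exp (u (φ.symm z)) - 2) := by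
  have h1 := hu.2 φ hφ z hz
  have h2 := hφ.density_pos k.toRiemannianMetric hz
  rw [hk.2 φ hφ z hz] at h1
  have h3 : 0 ≤ 4 * Real.exp (-2 * u (φ.symm z)) * cubicNormSq k.toRiemannianMetric U φ z := by
    rw [cubicNormSq]; positivity
  have h4 : laplaceBeltrami k.toRiemannianMetric u φ z ≤ 2 * Real.exp (u (φ.symm z)) - 2 := by
    linarith
  rw [laplaceBeltrami, div_le_iff₀ h2] at h4
  linarith

/-- The Blaschke metric has curvature at least `-1`. -/
theorem SolvesWang.laplacian_logDensity_le {U : CubicDifferential S}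
    (hk : IsConformalHyperbolic k.toRiemannianMetric)
    (hu : SolvesWang k.toRiemannianMetric U u)
    (hh : ∀ (p : S) (v w : TangentSpace 𝓘(ℝ, ℂ) p),
      h.inner p v w = Real.exp (u p) * k.inner p v w) (hφ : IsHolChart φ) {z : ℂ}
    (hz : z ∈ φ.target) : Δ (logDensity h φ) z ≤ 2 * Real.exp (logDensity h φ z) := by
  rw [(InnerProductSpace.laplacian_congr_nhds (logDensity_rescale_eventuallyEq hφ hh hz)).eq_of_nhds,
    (hφ.contDiffAt_comp_symm hu.1 hz).laplacian_add (hφ.contDiffAt_logDensity k hz),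
    hk.laplacian_logDensity hφ hz, hφ.exp_logDensity h hz, density_rescale hh]
  -- `λ (2 e^u - 2)` from `u` and `2 λ` from the curvature of `k` add up to `2 e^u λ`.
  linarith [hu.laplacian_le hk hφ hz]

/-- Passing from `k` to `h` multiplies the density by `e^u`, and `e^u (2 e^{-u} - 2) = 2 - 2 e^u`:
this is the previous differential inequality negated. -/
theorem SolvesWang.le_laplacian_neg {U : CubicDifferential S}
    (hk : IsConformalHyperbolic k.toRiemannianMetric)
    (hu : SolvesWang k.toRiemannianMetric U u)
    (hh : ∀ (p : S) (v w : TangentSpace 𝓘(ℝ, ℂ) p),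
      h.inner p v w = Real.exp (u p) * k.inner p v w) (hφ : IsHolChart φ) {z : ℂ}
    (hz : z ∈ φ.target) :
    Real.exp (logDensity h φ z) * (2 * Real.exp (-u (φ.symm z)) - 2)
      ≤ Δ (fun z ↦ -u (φ.symm z)) z := by
  have h1 : Δ (fun z ↦ -u (φ.symm z)) z = -Δ (fun z ↦ u (φ.symm z)) z :=
    congrFun (InnerProductSpace.laplacian_neg (f := fun z ↦ u (φ.symm z))) z
  rw [h1, hφ.exp_logDensity h hz, density_rescale hh]
  have h2 := hu.laplacian_le hk hφ hz
  have h3 : Real.exp (u (φ.symm z)) * Real.exp (-u (φ.symm z)) = 1 := by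
    rw [← Real.exp_add, add_neg_cancel, Real.exp_zero]
  calc _ = density k.toRiemannianMetric φ z * (2 * (Real.exp (u (φ.symm z))
        * Real.exp (-u (φ.symm z))) - 2 * Real.exp (u (φ.symm z))) := by ring
    _ ≤ _ := by rw [h3]; linarith

/-- A solution of Wang's equation whose Blaschke metric is complete is nonnegative. -/
theorem SolvesWang.nonneg [T2Space S] {U : CubicDifferential S}
    (hk : IsConformalHyperbolic k.toRiemannianMetric)
    (hu : SolvesWang k.toRiemannianMetric U u)
    (hh : ∀ (p : S) (v w : TangentSpace 𝓘(ℝ, ℂ) p),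
      h.inner p v w = Real.exp (u p) * k.inner p v w) (hc : IsCompleteMetric h) (o : S) :
    0 ≤ u o := by
  let iR : Bundle.RiemannianBundle (fun p : S ↦ TangentSpace 𝓘(ℝ, ℂ) p) := ⟨h⟩
  have : IsContinuousRiemannianBundle ℂ (fun p : S ↦ TangentSpace 𝓘(ℝ, ℂ) p) :=
    isContinuousRiemannianBundle_of_conformal k (Real.continuous_exp.comp hu.1.continuous) h hh
  have : LocallyCompactSpace S := ChartedSpace.locallyCompactSpace ℂ S
  let iM : PseudoEMetricSpace S := PseudoEMetricSpace.ofRiemannianMetric 𝓘(ℝ, ℂ) S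
  have hg := isConformal_rescale hk.1 hh
  have hconf := fun {φ : OpenPartialHomeomorph S ℂ} (hφ : IsHolChart φ) z hz ξ ↦
    hg.norm_realVec hφ (z := z) hz ξ
  have hC := fun {φ : OpenPartialHomeomorph S ℂ} (hφ : IsHolChart φ) z hz ↦
    contDiffAt_logDensity_rescale hφ hu.1 hh (z := z) hz
  -- The extended distance placed on `S` is the Riemannian distance of `h`, so its Cauchy sequences
  -- are those in `IsCompleteMetric`.
  have hcomplete : CompleteSpace S := EMetric.complete_of_cauchySeq_tendsto fun x hx ↦
    hc x fun ε hε ↦ EMetric.cauchySeq_iff.1 hx ε hε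
  have hX : HasIntermediatePoints S :=
    exists_intermediate_riemannianEDist fun x ↦ continuous_const.edist continuous_id
  have hA : IsConformalAtlas {φ : OpenPartialHomeomorph S ℂ | IsHolChart φ} (logDensity h) :=
    { exists_chart := fun p ↦ ⟨chartAt ℂ p, IsManifold.chart_mem_maximalAtlas p,
        mem_chart_source ℂ p⟩
      contDiffAt := fun φ hφ z hz ↦ hC hφ z hz
      laplacian_le := fun φ hφ z hz ↦ hu.laplacian_logDensity_le hk hh hφ hz
      edist_le := fun φ hφ c c' hcc ht ↦
        hφ.riemannianEDist_le (hconf hφ) (fun z hz ↦ (hC hφ z hz).continuousAt) hcc ht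
      exists_curve := fun φ hφ x y D hD hs ↦ by
        obtain ⟨c, c', hcc, h0, h1, ht, hl⟩ := hφ.exists_curve (hconf hφ)
          (fun z hz ↦ (hC hφ z hz).continuousAt) hD fun q hq ↦ hs (Metric.mem_eball'.2 hq)
        exact ⟨c, c', hcc, h0, h1, fun t htt ↦ ⟨(ht t htt).1, Metric.mem_eball'.2 (ht t htt).2⟩, hl⟩
      analyticAt := fun φ hφ ψ hψ z hz hz' ↦ hφ.analyticAt_transition hψ hz hz'
      density_eq := fun φ hφ ψ hψ z hz hz' ↦ hg.exp_logDensity_transition hφ hψ hz hz' }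
  have : -u o ≤ 0 := hA.nonpos_of_laplacian_ge hX hX.isCompact_closedEBall hu.1.continuous.neg
    (fun φ hφ z hz ↦ (IsHolChart.contDiffAt_comp_symm hφ hu.1 hz).neg)
    (fun φ hφ z hz ↦ hu.le_laplacian_neg hk hh hφ hz) o
  linarith

end Rescale

end WangSurface
end

theorem mainTheorem10 {S : Type*} [TopologicalSpace S] [T2Space S] [ChartedSpace ℂ S]
    [IsManifold 𝓘(ℂ) ω S]
    (k : WangSurface.SmoothMetric S)
    (hk : WangSurface.IsConformalHyperbolic k.toRiemannianMetric)
    (hkc : WangSurface.IsCompleteMetric k.toRiemannianMetric)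
    (U : WangSurface.CubicDifferential S)
    (u : S → ℝ) (hu : WangSurface.SolvesWang k.toRiemannianMetric U u)
    (h : WangSurface.Metric S)
    (hh : ∀ (p : S) (v w : TangentSpace 𝓘(ℝ, ℂ) p),
      h.inner p v w = Real.exp (u p) * k.inner p v w)
    (hc : WangSurface.IsCompleteMetric h) :
    ∀ (p : S) (v : TangentSpace 𝓘(ℝ, ℂ) p), k.inner p v v ≤ h.inner p v v := by
  intro p v
  have h0 : 0 ≤ k.inner p v v := by
    rcases eq_or_ne v 0 with rfl | hv
    · simp
    · exact (k.pos p v hv).le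
  rw [hh]
  exact le_mul_of_one_le_left h0 (Real.one_le_exp (hu.nonneg hk hh hc p))
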